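/- Let $\Gamma$ be a group with an orientation preserving continuous action on $S^1=\mathbb{R}/\mathbb{Z}$, i.e., a homomorphism $\rho\colon\Gamma\to\mathrm{Homeo}^+(S^1)$. For $g\in\Gamma$ let $\tilde g\colon\mathbb{R}\to\mathbb{R}$ be the lift of $\rho(g)$ with $\tilde g(0)\in[0,1)$, and let $c(g,h)\in\{0,1\}$ be given by $\tilde g\circ\tilde h=\widetilde{gh}+c(g,h)$. The classes of $c$ in $H^2(\Gamma;\mathbb{Z})$ and in bounded cohomology $H^2_b(\Gamma;\mathbb{R})$ are the Euler class $\mathrm{eu}$ and the bounded Euler class $\mathrm{eu}_b$. Assume that $\Gamma$ is finitely presented; that $H_1(\Gamma;\mathbb{Z})$ is finite; that every quasimorphism $\Gamma\to\mathbb{R}$ is trivial, i.e., at bounded distance from a homomorphism; and that $H^2_b(\Gamma;\mathbb{R})$ is one-dimensional and generated by $\mathrm{eu}_b$. Let $\widetilde\Gamma$ be the central extension of $\Gamma$ by $\mathbb{Z}$ with class $\mathrm{eu}$, and let $H:=H_2(\Gamma;\mathbb{Z})$. Then the image of the evaluation map $\langle\mathrm{eu},\cdot\rangle\colon H\to\mathbb{Z}$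 is $m\mathbb{Z}$ for some integer $m>0$. Let $\epsilon:=\frac1m\langle\mathrm{eu},\cdot\rangle\colon H\to\mathbb{Z}$. There exists a class $\varphi\in H^2(\Gamma;H)$ with $H^2(\mathrm{id}_\Gamma;\epsilon)(\varphi)=\mathrm{eu}$ and $\langle\varphi,\cdot\rangle=m\cdot\mathrm{id}_H$. For every such $\varphi$, let $E$ be the central extension of $\Gamma$ by $H$ with class $\varphi$. There exists an epimorphism $\psi\colon E\to\widetilde\Gamma$ with $\psi|_H=\epsilon$ and $\ker\psi\subset H$ that induces the identity on $\Gamma$. Moreover: 1. The group $E$ is finitely presented and $H_2(E;\mathbb{R})\cong 0$. 2. For a group $G$ let $Q(G)$ be the real vector space of quasimorphisms $G\to\mathbb{R}$ modulo trivial quasimorphisms. Every epimorphism $\psi\colon E\to\widetilde\Gamma$ with $\psi|_H=\epsilon$ and $\ker\psi\subset H$ induces an isomorphism $Q(\psi)\colon Q(\widetilde\Gamma)\to Q(E)$, $[f]\mapsto[f\circ\psi]$, and both spaces are one-dimensional. 3. We have $\mathrm{scl}_E([E,E])=\mathrm{scl}_{\widetilde\Gamma}([\widetilde\Gamma,\widetilde\Gamma])$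 as subsets of $\mathbb{R}$, where $\mathrm{scl}_G(g)=\lim_{n\to\infty}\mathrm{cl}_G(g^n)/n$ and $\mathrm{cl}_G$ is the commutator length. -/

import Mathlib

open CategoryTheory

noncomputable section

/-! ### Second group (co)homology with trivial coefficients and the Kronecker pairing -/

section Kronecker

universe u

variable (k G : Type u) [CommRing k] [Group G]

/-- `H_n(G; k)`, for the trivial `G`-action on `k`. -/
abbrev trivialHomology (n : ℕ) : ModuleCat.{u} k := groupHomology (Rep.trivial k G k) n

variable {k}

/-- `H²(G; A)`, for the trivial `G`-action on the `k`-module `A`. -/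
abbrev trivialCohomology₂ (A : ModuleCat.{u} k) : ModuleCat.{u} k :=
  groupCohomology.H2 (Rep.trivial k G A)

variable {G}

/-- The map `H²(id_G; f) : H²(G; A) ⟶ H²(G; B)` induced by a homomorphism `f : A ⟶ B` of
coefficient modules. -/
def coefficientMap₂ {A B : ModuleCat.{u} k} (f : A ⟶ B) :
    trivialCohomology₂ G A ⟶ trivialCohomology₂ G B :=
  groupCohomology.map (MonoidHom.id G) ((Rep.trivialFunctor k G).map f) 2

/-- Descend a linear map along a surjective linear map. -/
def LinearMap.descend {M N P : Type*} [AddCommGroup M] [AddCommGroup N] [AddCommGroup P]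
    [Module k M] [Module k N] [Module k P] (p : M →ₗ[k] N) (hp : Function.Surjective p)
    (f : M →ₗ[k] P) (h : LinearMap.ker p ≤ LinearMap.ker f) : N →ₗ[k] P :=
  (LinearMap.ker p).liftQ f h ∘ₗ (p.quotKerEquivOfSurjective hp).symm.toLinearMap

theorem LinearMap.descend_apply {M N P : Type*} [AddCommGroup M] [AddCommGroup N]
    [AddCommGroup P] [Module k M] [Module k N] [Module k P] (p : M →ₗ[k] N)
    (hp : Function.Surjective p) (f : M →ₗ[k] P) (h : LinearMap.ker p ≤ LinearMap.ker f) (x : M) :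
    p.descend hp f h (p x) = f x := by
  have : (p.quotKerEquivOfSurjective hp).symm (p x) = (LinearMap.ker p).mkQ x := by
    rw [LinearEquiv.symm_apply_eq]; rfl
  simp [LinearMap.descend, this]

theorem groupHomology_H2π_surjective (A : Rep.{u} k G) :
    Function.Surjective (groupHomology.H2π A).hom := fun y =>
  groupHomology.H2_induction_on y fun x => ⟨x, rfl⟩

theorem groupCohomology_H2π_surjective (A : Rep.{u} k G) :
    Function.Surjective (groupCohomology.H2π A).hom := fun y =>
  groupCohomology.H2_induction_on y fun x => ⟨x, rfl⟩

variable {A : ModuleCat.{u} k}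

theorem kronecker_boundary (c : groupCohomology.cocycles₂ (Rep.trivial k G A))
    (z : G × G →₀ k) (hz : z ∈ groupHomology.boundaries₂ (Rep.trivial k G k)) :
    Finsupp.linearCombination k (fun x : G × G => (c.1 x : A)) z = 0 := by
  obtain ⟨w, rfl⟩ := hz
  induction w using Finsupp.induction_linear with
  | zero => simp
  | add f g hf hg => rw [map_add, map_add, hf, hg, add_zero]
  | single x r =>
    obtain ⟨g, h, j⟩ := x
    have hc : (c.1 (g * h, j) : A) + c.1 (g, h) = c.1 (h, j) + c.1 (g, h * j) :=
      (groupCohomology.mem_cocycles₂_iff c.1).1 c.2 g h j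
    erw [groupHomology.d₃₂_single]
    simp only [map_add, map_sub, Finsupp.linearCombination_single]
    change r • (c.1 (h, j) : A) - r • (c.1 (g * h, j) : A) + r • (c.1 (g, h * j) : A)
      - r • (c.1 (g, h) : A) = 0
    rw [← smul_sub, ← smul_add, ← smul_sub, eq_sub_of_add_eq hc]
    simp [sub_sub_eq_add_sub]

theorem kronecker_coboundary (c : groupCohomology.cocycles₂ (Rep.trivial k G A))
    (hc : c.1 ∈ groupCohomology.coboundaries₂ (Rep.trivial k G A))
    (z : groupHomology.cycles₂ (Rep.trivial k G k)) :
    Finsupp.linearCombination k (fun x : G × G => (c.1 x : A)) z.1 = 0 := by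
  obtain ⟨f, hf⟩ := hc
  have key : ∀ w : G × G →₀ k,
      Finsupp.linearCombination k (fun x : G × G => (c.1 x : A)) w =
        Finsupp.linearCombination k (fun x : G => (f x : A))
          ((groupHomology.d₂₁ (Rep.trivial k G k)).hom w) := by
    intro w
    induction w using Finsupp.induction_linear with
    | zero => simp
    | add f g hf hg => rw [map_add, map_add, map_add, hf, hg]
    | single x r =>
      obtain ⟨g, h⟩ := x
      have hx : (c.1 (g, h) : A) = f h - f (g * h) + f g := (congrFun hf (g, h)).symm
      erw [groupHomology.d₂₁_single]
      simp only [map_add, map_sub, Finsupp.linearCombination_single]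
      change r • (c.1 (g, h) : A) = r • (f h : A) - r • (f (g * h) : A) + r • (f g : A)
      rw [hx, smul_add, smul_sub]
  rw [key, LinearMap.mem_ker.1 z.2, map_zero]

/-- The evaluation `H_2(G; k) → A` of a 2-cocycle `c` of `G` with values in `A`: the class of a
cycle `∑ r_i (g_i, h_i)` is mapped to `∑ r_i c(g_i, h_i)`. -/
def kroneckerCocycle (c : groupCohomology.cocycles₂ (Rep.trivial k G A)) :
    trivialHomology k G 2 →ₗ[k] A :=
  (groupHomology.H2π (Rep.trivial k G k)).hom.descend (groupHomology_H2π_surjective _)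
    (Finsupp.linearCombination k (fun x : G × G => (c.1 x : A)) ∘ₗ
      (groupHomology.cycles₂ (Rep.trivial k G k)).subtype)
    (fun z hz => kronecker_boundary c z.1 ((groupHomology.H2π_eq_zero_iff z).1 hz))

theorem kroneckerCocycle_H2π (c : groupCohomology.cocycles₂ (Rep.trivial k G A))
    (z : groupHomology.cycles₂ (Rep.trivial k G k)) :
    kroneckerCocycle c ((groupHomology.H2π (Rep.trivial k G k)).hom z) =
      Finsupp.linearCombination k (fun x : G × G => (c.1 x : A)) z.1 :=
  LinearMap.descend_apply _ (groupHomology_H2π_surjective _) _ _ z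

/-- The Kronecker pairing `H²(G; A) → Hom_k(H_2(G; k), A)`, `φ ↦ ⟨φ, ·⟩`. -/
def kronecker : trivialCohomology₂ G A →ₗ[k] trivialHomology k G 2 →ₗ[k] A :=
  (groupCohomology.H2π (Rep.trivial k G A)).hom.descend (groupCohomology_H2π_surjective _)
    { toFun := kroneckerCocycle
      map_add' := fun c d => by
        ext y
        obtain ⟨z, rfl⟩ := groupHomology_H2π_surjective _ y
        rw [LinearMap.add_apply]
        erw [kroneckerCocycle_H2π, kroneckerCocycle_H2π, kroneckerCocycle_H2π]
        simp only [Finsupp.linearCombination_apply, Finsupp.sum]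
        rw [← Finset.sum_add_distrib]
        exact Finset.sum_congr rfl fun x _ => smul_add _ (c.1 x : A) (d.1 x)
      map_smul' := fun r c => by
        ext y
        obtain ⟨z, rfl⟩ := groupHomology_H2π_surjective _ y
        rw [RingHom.id_apply, LinearMap.smul_apply]
        erw [kroneckerCocycle_H2π, kroneckerCocycle_H2π]
        simp only [Finsupp.linearCombination_apply, Finsupp.sum]
        rw [Finset.smul_sum]
        exact Finset.sum_congr rfl fun x _ => smul_comm _ r (c.1 x : A) }
    (fun c hc => by
      have hc' := (groupCohomology.H2π_eq_zero_iff c).1 hc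
      refine LinearMap.mem_ker.2 (LinearMap.ext fun y => ?_)
      obtain ⟨z, rfl⟩ := groupHomology_H2π_surjective _ y
      exact (kroneckerCocycle_H2π c z).trans (kronecker_coboundary c hc' z))

/-- The formula for the Kronecker pairing on representatives. -/
theorem kronecker_H2π (c : groupCohomology.cocycles₂ (Rep.trivial k G A))
    (z : groupHomology.cycles₂ (Rep.trivial k G k)) :
    kronecker ((groupCohomology.H2π (Rep.trivial k G A)).hom c)
        ((groupHomology.H2π (Rep.trivial k G k)).hom z) =
      Finsupp.linearCombination k (fun x : G × G => (c.1 x : A)) z.1 := by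
  refine Eq.trans ?_ (kroneckerCocycle_H2π c z)
  exact LinearMap.congr_fun (LinearMap.descend_apply _ (groupCohomology_H2π_surjective _) _ _ c) _

end Kronecker

/-! ### Central extensions -/

/-- The extension `1 → A → E → Γ → 1` is central and its class is `φ ∈ H²(Γ; A)`: for some
set-theoretic section `σ`, the class `φ` is represented by the 2-cocycle `c` that is
given by `σ(g) σ(h) = c(g, h) σ(g h)`. -/
def IsCentralExtensionOfClass {Γ E : Type} [Group Γ] [Group E] {A : ModuleCat.{0} ℤ}
    (S : GroupExtension (Multiplicative A) E Γ) (φ : trivialCohomology₂ Γ A) : Prop :=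
  S.inl.range ≤ Subgroup.center E ∧
    ∃ (σ : S.Section) (c : groupCohomology.cocycles₂ (Rep.trivial ℤ Γ A)),
      (∀ g h : Γ, σ g * σ h = S.inl (Multiplicative.ofAdd (c.1 (g, h) : A)) * σ (g * h)) ∧
      groupCohomology.H2π (Rep.trivial ℤ Γ A) c = φ

/-! ### Quasimorphisms and stable commutator length -/

section Quasimorphisms

/-- The real vector space of quasimorphisms on `G`. -/
def quasimorphisms (G : Type*) [Group G] : Submodule ℝ (G → ℝ) where
  carrier := {f | ∃ D : ℝ, ∀ g h, |f (g * h) - f g - f h| ≤ D}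
  zero_mem' := ⟨0, by simp⟩
  add_mem' := by
    rintro f₁ f₂ ⟨D₁, h₁⟩ ⟨D₂, h₂⟩
    refine ⟨D₁ + D₂, fun g h => ?_⟩
    calc |(f₁ + f₂) (g * h) - (f₁ + f₂) g - (f₁ + f₂) h|
        = |(f₁ (g * h) - f₁ g - f₁ h) + (f₂ (g * h) - f₂ g - f₂ h)| := by
          simp only [Pi.add_apply]; ring_nf
      _ ≤ D₁ + D₂ := (abs_add_le _ _).trans (add_le_add (h₁ g h) (h₂ g h))
  smul_mem' := by
    rintro r f ⟨D, hD⟩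
    refine ⟨|r| * D, fun g h => ?_⟩
    simp only [Pi.smul_apply, smul_eq_mul]
    rw [← mul_sub, ← mul_sub, abs_mul]
    exact mul_le_mul_of_nonneg_left (hD g h) (abs_nonneg r)

/-- The trivial quasimorphisms: those at bounded distance from a homomorphism to `ℝ`. -/
def trivialQuasimorphisms (G : Type*) [Group G] : Submodule ℝ (quasimorphisms G) where
  carrier := {f | ∃ (χ : Additive G →+ ℝ) (C : ℝ), ∀ g, |f.1 g - χ (Additive.ofMul g)| ≤ C}
  zero_mem' := ⟨0, 0, by simp⟩
  add_mem' := by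
    rintro f₁ f₂ ⟨χ₁, C₁, h₁⟩ ⟨χ₂, C₂, h₂⟩
    refine ⟨χ₁ + χ₂, C₁ + C₂, fun g => ?_⟩
    have : (f₁ + f₂).1 g - (χ₁ + χ₂) (Additive.ofMul g) =
        (f₁.1 g - χ₁ (Additive.ofMul g)) + (f₂.1 g - χ₂ (Additive.ofMul g)) := by
      simp only [Submodule.coe_add, Pi.add_apply, AddMonoidHom.add_apply]; ring
    rw [this]
    exact (abs_add_le _ _).trans (add_le_add (h₁ g) (h₂ g))
  smul_mem' := by
    rintro r f ⟨χ, C, hC⟩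
    refine ⟨(AddMonoidHom.mulLeft r).comp χ, |r| * C, fun g => ?_⟩
    have : (r • f).1 g - ((AddMonoidHom.mulLeft r).comp χ) (Additive.ofMul g) =
        r * (f.1 g - χ (Additive.ofMul g)) := by
      simp [mul_sub]
    rw [this, abs_mul]
    exact mul_le_mul_of_nonneg_left (hC g) (abs_nonneg r)

/-- The space `Q(G)` of quasimorphisms modulo trivial quasimorphisms. -/
abbrev QuasimorphismSpace (G : Type*) [Group G] : Type _ :=
  quasimorphisms G ⧸ trivialQuasimorphisms G

/-- Precomposition of quasimorphisms with a homomorphism. -/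
def quasimorphismComp {G G' : Type*} [Group G] [Group G'] (ψ : G →* G') :
    quasimorphisms G' →ₗ[ℝ] quasimorphisms G where
  toFun f := ⟨f.1 ∘ ψ, by
    obtain ⟨D, hD⟩ := f.2
    exact ⟨D, fun g h => by simpa using hD (ψ g) (ψ h)⟩⟩
  map_add' _ _ := rfl
  map_smul' _ _ := rfl

/-- The map `Q(ψ) : Q(G') → Q(G)`, `[f] ↦ [f ∘ ψ]`. -/
def quasimorphismMap {G G' : Type*} [Group G] [Group G'] (ψ : G →* G') :
    QuasimorphismSpace G' →ₗ[ℝ] QuasimorphismSpace G :=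
  Submodule.mapQ _ _ (quasimorphismComp ψ) (by
    rintro f ⟨χ, C, hC⟩
    exact ⟨χ.comp (MonoidHom.toAdditive ψ), C, fun g => hC (ψ g)⟩)

/-- The commutator length of `g`: the least number of commutators whose product is `g`
(only meaningful for `g` in the commutator subgroup). -/
def commutatorLength {G : Type*} [Group G] (g : G) : ℕ :=
  sInf {n | ∃ l : List G, l.length = n ∧ (∀ x ∈ l, x ∈ commutatorSet G) ∧ l.prod = g}

/-- The stable commutator length `scl g = lim_{n → ∞} cl(g ^ n) / n`
(only meaningful for `g` in the commutator subgroup, where the limit exists). -/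
def scl {G : Type*} [Group G] (g : G) : ℝ :=
  Filter.limUnder Filter.atTop fun n : ℕ => (commutatorLength (g ^ n) : ℝ) / n

end Quasimorphisms

/-! ### Second bounded cohomology with real coefficients -/

section BoundedCohomology

/-- Bounded real 2-cocycles. -/
def boundedCocycles₂ (G : Type) [Group G] : Submodule ℝ (G × G → ℝ) where
  carrier := {c | c ∈ groupCohomology.cocycles₂ (Rep.trivial ℝ G ℝ) ∧ ∃ C : ℝ, ∀ x, |c x| ≤ C}
  zero_mem' := ⟨Submodule.zero_mem _, 0, by simp⟩
  add_mem' := by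
    rintro c₁ c₂ ⟨h₁, C₁, hC₁⟩ ⟨h₂, C₂, hC₂⟩
    exact ⟨Submodule.add_mem _ h₁ h₂, C₁ + C₂,
      fun x => (abs_add_le _ _).trans (add_le_add (hC₁ x) (hC₂ x))⟩
  smul_mem' := by
    rintro r c ⟨h, C, hC⟩
    refine ⟨Submodule.smul_mem _ r h, |r| * C, fun x => ?_⟩
    rw [Pi.smul_apply, smul_eq_mul, abs_mul]
    exact mul_le_mul_of_nonneg_left (hC x) (abs_nonneg r)

/-- Coboundaries of bounded real 1-cochains. -/
def boundedCoboundaries₂ (G : Type) [Group G] : Submodule ℝ (boundedCocycles₂ G) where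
  carrier := {c | ∃ f : G → ℝ, (∃ C : ℝ, ∀ g, |f g| ≤ C) ∧
    ∀ g h, c.1 (g, h) = f h - f (g * h) + f g}
  zero_mem' := ⟨0, ⟨0, by simp⟩, by simp⟩
  add_mem' := by
    rintro c₁ c₂ ⟨f₁, ⟨C₁, hC₁⟩, h₁⟩ ⟨f₂, ⟨C₂, hC₂⟩, h₂⟩
    refine ⟨f₁ + f₂, ⟨C₁ + C₂, fun x => (abs_add_le _ _).trans (add_le_add (hC₁ x) (hC₂ x))⟩,
      fun g h => ?_⟩
    simp only [Submodule.coe_add, Pi.add_apply, h₁, h₂]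
    ring
  smul_mem' := by
    rintro r c ⟨f, ⟨C, hC⟩, h⟩
    refine ⟨r • f, ⟨|r| * C, fun x => ?_⟩, fun g h' => ?_⟩
    · rw [Pi.smul_apply, smul_eq_mul, abs_mul]
      exact mul_le_mul_of_nonneg_left (hC x) (abs_nonneg r)
    · simp only [Submodule.coe_smul, Pi.smul_apply, smul_eq_mul, h]
      ring

/-- The second bounded cohomology `H²_b(G; ℝ)`. -/
abbrev BoundedCohomology₂ (G : Type) [Group G] : Type :=
  boundedCocycles₂ G ⧸ boundedCoboundaries₂ G

end BoundedCohomology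

/-! ### Actions on the circle and the Euler class -/

section Euler

/-- The group `Homeo⁺(S¹)` of orientation preserving homeomorphisms of `S¹ = ℝ/ℤ`, i.e., of
those homeomorphisms that lift to an increasing bijection `F : ℝ → ℝ` with
`F (x + 1) = F x + 1`. -/
def HomeoPlus : Subgroup (UnitAddCircle ≃ₜ UnitAddCircle) where
  carrier := {h | ∃ F : CircleDeg1Liftˣ, ∀ x : ℝ, h (x : UnitAddCircle) = (F x : UnitAddCircle)}
  one_mem' := ⟨1, fun _ => rfl⟩
  mul_mem' := by
    rintro h₁ h₂ ⟨F₁, hF₁⟩ ⟨F₂, hF₂⟩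
    refine ⟨F₁ * F₂, fun x => ?_⟩
    change h₁ (h₂ x) = _
    rw [hF₂, hF₁]
    rfl
  inv_mem' := by
    rintro h ⟨F, hF⟩
    refine ⟨F⁻¹, fun x => ?_⟩
    change h.symm x = _
    rw [Homeomorph.symm_apply_eq, hF, CircleDeg1Lift.units_apply_inv_apply]

theorem exists_circleLift (h : HomeoPlus) : ∃ F : CircleDeg1Liftˣ,
    (∀ x : ℝ, h.1 (x : UnitAddCircle) = (F x : UnitAddCircle)) ∧ F 0 ∈ Set.Ico (0 : ℝ) 1 := by
  obtain ⟨F, hF⟩ := h.2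
  refine ⟨CircleDeg1Lift.translate (Multiplicative.ofAdd (-(⌊F 0⌋ : ℝ))) * F, fun x => ?_, ?_, ?_⟩
  · rw [hF, Units.val_mul, CircleDeg1Lift.mul_apply, CircleDeg1Lift.translate_apply,
      eq_comm, ← sub_eq_zero, ← AddCircle.coe_sub, AddCircle.coe_eq_zero_iff]
    exact ⟨-⌊F 0⌋, by simp⟩
  · rw [Units.val_mul, CircleDeg1Lift.mul_apply, CircleDeg1Lift.translate_apply]
    linarith [Int.floor_le (F 0)]
  · rw [Units.val_mul, CircleDeg1Lift.mul_apply, CircleDeg1Lift.translate_apply]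
    linarith [Int.lt_floor_add_one (F 0)]

/-- The lift `F` of an orientation preserving homeomorphism that is normalised by
`F 0 ∈ [0, 1)`. -/
def circleLift (h : HomeoPlus) : CircleDeg1Liftˣ := (exists_circleLift h).choose

theorem coe_circleLift (h : HomeoPlus) (x : ℝ) :
    h.1 (x : UnitAddCircle) = (circleLift h x : UnitAddCircle) := (exists_circleLift h).choose_spec.1 x

theorem circleLift_zero_mem (h : HomeoPlus) : circleLift h 0 ∈ Set.Ico (0 : ℝ) 1 :=
  (exists_circleLift h).choose_spec.2

theorem CircleDeg1Lift.eq_add_int_of_coe_eq (K : CircleDeg1Lift)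
    (hK : ∀ x : ℝ, (K x : UnitAddCircle) = x) (x : ℝ) : K x = x + K 0 := by
  have hint : ∀ y : ℝ, ∃ n : ℤ, K y = y + n := fun y => by
    have := hK y
    rw [← sub_eq_zero, ← AddCircle.coe_sub, AddCircle.coe_eq_zero_iff] at this
    obtain ⟨n, hn⟩ := this
    exact ⟨n, by rw [zsmul_one] at hn; linarith⟩
  have hfr : K (Int.fract x) = Int.fract x + K 0 := by
    obtain ⟨n, hn⟩ := hint (Int.fract x)
    obtain ⟨m, hm⟩ := hint 0
    have h1 := K.mono (Int.fract_nonneg x)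
    have h2 := K.mono (Int.fract_lt_one x).le
    have h3 : K 1 = K 0 + 1 := by simpa using K.map_add_one 0
    have h4 := Int.fract_nonneg x
    have h5 := Int.fract_lt_one x
    rcases h4.eq_or_lt with h | h
    · rw [← h]; simp
    have : m = n := by
      have a1 : (m : ℝ) < n + 1 := by linarith
      have a2 : (n : ℝ) < m + 1 := by linarith
      have b1 : m < n + 1 := by exact_mod_cast a1
      have b2 : n < m + 1 := by exact_mod_cast a2
      omega
    rw [hn, hm, this, zero_add]
  have : K x = K (Int.fract x) + ⌊x⌋ := by
    rw [← K.map_add_int, Int.fract_add_floor]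
  rw [this, hfr]
  linarith [Int.fract_add_floor x]

variable {Γ : Type} [Group Γ] (ρ : Γ →* HomeoPlus)

/-- The integral Euler cocycle of an orientation preserving action on the circle: with `g̃` the
lift of `ρ(g)` such that `g̃(0) ∈ [0, 1)`, the integer `c(g, h)` is determined by
`g̃ ∘ h̃ = (gh)~ + c(g, h)` (see `circleLift_comp`), i.e., `c(g, h) = ⌊g̃(h̃(0))⌋`. -/
def eulerCocycle (x : Γ × Γ) : ℤ := ⌊(circleLift (ρ x.1)) ((circleLift (ρ x.2)) 0)⌋

theorem circleLift_comp (g h : Γ) (x : ℝ) :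
    (circleLift (ρ g)) ((circleLift (ρ h)) x) = (circleLift (ρ (g * h))) x + eulerCocycle ρ (g, h) := by
  have key : ∀ y, (circleLift (ρ g)) ((circleLift (ρ h)) (((circleLift (ρ (g * h)))⁻¹ : CircleDeg1Liftˣ) y)) =
      y + ((circleLift (ρ g)) * (circleLift (ρ h)) * (circleLift (ρ (g * h)))⁻¹ : CircleDeg1Liftˣ) 0 := fun y => by
    refine CircleDeg1Lift.eq_add_int_of_coe_eq
      ((circleLift (ρ g)) * (circleLift (ρ h)) * (circleLift (ρ (g * h)))⁻¹ : CircleDeg1Liftˣ) (fun z => ?_) y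
    change (((circleLift (ρ g)) ((circleLift (ρ h)) (((circleLift (ρ (g * h)))⁻¹ : CircleDeg1Liftˣ) z)) : ℝ) :
      UnitAddCircle) = z
    rw [← coe_circleLift, ← coe_circleLift]
    have : ∀ w : UnitAddCircle, (ρ g).1 ((ρ h).1 w) = (ρ (g * h)).1 w := fun w => by
      rw [map_mul]; rfl
    rw [this, coe_circleLift, CircleDeg1Lift.units_apply_inv_apply]
  set t := ((circleLift (ρ g)) * (circleLift (ρ h)) * (circleLift (ρ (g * h)))⁻¹ : CircleDeg1Liftˣ) 0 with ht
  have key' : ∀ x, (circleLift (ρ g)) ((circleLift (ρ h)) x) = (circleLift (ρ (g * h))) x + t := fun x => by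
    simpa using key ((circleLift (ρ (g * h))) x)
  have hz : ∃ n : ℤ, t = n := by
    have h0 : (((circleLift (ρ g)) * (circleLift (ρ h)) * (circleLift (ρ (g * h)))⁻¹ : CircleDeg1Liftˣ) 0 :
        UnitAddCircle) = (0 : ℝ) := by
      change (((circleLift (ρ g)) ((circleLift (ρ h)) (((circleLift (ρ (g * h)))⁻¹ : CircleDeg1Liftˣ) 0)) : ℝ) :
        UnitAddCircle) = (0 : ℝ)
      rw [← coe_circleLift, ← coe_circleLift]
      have : ∀ w : UnitAddCircle, (ρ g).1 ((ρ h).1 w) = (ρ (g * h)).1 w := fun w => by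
        rw [map_mul]; rfl
      rw [this, coe_circleLift, CircleDeg1Lift.units_apply_inv_apply]
    rw [AddCircle.coe_zero, AddCircle.coe_eq_zero_iff] at h0
    obtain ⟨n, hn⟩ := h0
    exact ⟨n, by rw [ht, ← hn]; simp⟩
  obtain ⟨n, hn⟩ := hz
  have : eulerCocycle ρ (g, h) = n := by
    have h1 := circleLift_zero_mem (ρ (g * h))
    rw [eulerCocycle, Int.floor_eq_iff]
    simp only [key' 0, hn]
    exact ⟨by linarith [h1.1], by linarith [h1.2]⟩
  rw [key', hn, this]

theorem eulerCocycle_identity (g h j : Γ) :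
    eulerCocycle ρ (g * h, j) + eulerCocycle ρ (g, h) =
      eulerCocycle ρ (h, j) + eulerCocycle ρ (g, h * j) := by
  have h1 := circleLift_comp ρ g h ((circleLift (ρ j)) 0)
  rw [circleLift_comp ρ h j, CircleDeg1Lift.map_add_int, circleLift_comp ρ g (h * j),
    circleLift_comp ρ (g * h) j, mul_assoc] at h1
  have h2 : ((eulerCocycle ρ (g * h, j) + eulerCocycle ρ (g, h) : ℤ) : ℝ) =
      ((eulerCocycle ρ (h, j) + eulerCocycle ρ (g, h * j) : ℤ) : ℝ) := by
    push_cast; linarith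
  exact_mod_cast h2

theorem eulerCocycle_mem (x : Γ × Γ) : 0 ≤ eulerCocycle ρ x ∧ eulerCocycle ρ x ≤ 1 := by
  have hg := circleLift_zero_mem (ρ x.1)
  have hh := circleLift_zero_mem (ρ x.2)
  have h1 := CircleDeg1Lift.mono (circleLift (ρ x.1)) hh.1
  have h2 := CircleDeg1Lift.mono (circleLift (ρ x.1)) hh.2.le
  have h3 : (circleLift (ρ x.1)) 1 = (circleLift (ρ x.1)) 0 + 1 := by
    simpa using CircleDeg1Lift.map_add_one (circleLift (ρ x.1)) 0
  constructor
  · exact Int.floor_nonneg.2 (hg.1.trans h1)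
  · have : eulerCocycle ρ x < 2 := by
      rw [eulerCocycle, Int.floor_lt]; push_cast; linarith [hg.2]
    omega

/-- The integral Euler class in `H²(Γ; ℤ)`. -/
def eulerClass : trivialCohomology₂ Γ (ModuleCat.of ℤ ℤ) :=
  groupCohomology.H2π (Rep.trivial ℤ Γ (ModuleCat.of ℤ ℤ))
    ⟨eulerCocycle ρ, (groupCohomology.mem_cocycles₂_iff _).2 (eulerCocycle_identity ρ)⟩

/-- The (real) bounded Euler class in `H²_b(Γ; ℝ)`. -/
def boundedEulerClass : BoundedCohomology₂ Γ :=
  Submodule.Quotient.mk ⟨fun x => (eulerCocycle ρ x : ℝ),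
    (groupCohomology.mem_cocycles₂_iff _).2 fun g h j => by
      change (eulerCocycle ρ (g * h, j) : ℝ) + eulerCocycle ρ (g, h) =
        eulerCocycle ρ (h, j) + eulerCocycle ρ (g, h * j)
      exact_mod_cast eulerCocycle_identity ρ g h j,
    1, fun x => by
      have h := eulerCocycle_mem ρ x
      have h0 : (0 : ℝ) ≤ eulerCocycle ρ x := by exact_mod_cast h.1
      have h1 : (eulerCocycle ρ x : ℝ) ≤ 1 := by exact_mod_cast h.2
      rw [abs_of_nonneg h0]
      exact h1⟩

/-- The standing assumptions on a group `Γ` with an orientation preserving action `ρ` on `S¹`. -/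
structure EulerSetup : Prop where
  finitelyPresented : Group.IsFinitelyPresented Γ
  finite_H1 : Finite (trivialHomology ℤ Γ 1)
  quasimorphism_trivial : ∀ f : quasimorphisms Γ, f ∈ trivialQuasimorphisms Γ
  finrank_boundedCohomology : Module.finrank ℝ (BoundedCohomology₂ Γ) = 1
  span_boundedEulerClass : Submodule.span ℝ {boundedEulerClass ρ} = ⊤

end Euler

end

/-!
Choose fibre coordinates on the central extension of `Γ` by `A` with cocycle `c`. As every
quasimorphism of `Γ` is bounded, a quasimorphism of the extension is, up to a bounded error,
`χ ∘ coord + b ∘ π` for a homomorphism `χ : A → ℝ` and a function `b : Γ → ℝ` such that `χ ∘ c - δb`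
is a bounded cocycle, that is, a multiple of the Euler cocycle in bounded cohomology. Now
`l ↦ [l ∘ c]` is injective on `Hom(A, ℝ)` whenever the image of `⟨[c], ·⟩` contains `m A` with
`m ≠ 0`. Hence the multiple determines the quasimorphism modulo trivial ones; it is nonzero for the
quasimorphism that exists because the real Euler class is in the image of the transgression.

For `E`, the homomorphism `χ` is a multiple of `ε`. So every quasimorphism of `E` is bounded on the
powers of an element of `ker ψ`, and such an element of `[E, E]` has stable commutator length zero
by Bavard duality. Since it is central, it does not affect the stable commutator length of products.

The equation `⟨φ, ·⟩ = m · id` also makes the transgression `Hom(H, ℝ) → H²(Γ; ℝ)` surjective. As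
`H¹(Γ; ℝ) = 0`, a 2-cocycle of `E` can be pushed down to `Γ`, and transgressions become coboundaries
in `E`, so `H²(E; ℝ) = 0`. Finally, a class evaluating to `m · id` becomes `φ` after subtraction of
`s (ε φ - eu)`, where `s` is a section of `ε`.
-/

section CommutatorLength

open scoped commutatorElement
open Filter Topology

variable {G G' : Type*} [Group G] [Group G']

/-- The element `g` is a product of at most `k` commutators. The inequality makes the predicate
monotone in `k`; its least witness is the commutator length. -/
def IsCommutatorProduct (k : ℕ) (g : G) : Prop :=
  ∃ l : List G, l.length ≤ k ∧ (∀ x ∈ l, x ∈ commutatorSet G) ∧ l.prod = g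

namespace IsCommutatorProduct

variable {k k' : ℕ} {g g' : G}

theorem one : IsCommutatorProduct 0 (1 : G) := ⟨[], by simp⟩

theorem mono (hk : k ≤ k') : IsCommutatorProduct k g → IsCommutatorProduct k' g :=
  fun ⟨l, hl, hc, hp⟩ => ⟨l, hl.trans hk, hc, hp⟩

theorem mul : IsCommutatorProduct k g → IsCommutatorProduct k' g' →
    IsCommutatorProduct (k + k') (g * g') := by
  rintro ⟨l, hl, hc, rfl⟩ ⟨l', hl', hc', rfl⟩
  exact ⟨l ++ l', by simp only [List.length_append]; omega, by simp; grind, List.prod_append⟩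

theorem of_commutator (a b : G) : IsCommutatorProduct 1 ⁅a, b⁆ :=
  ⟨[⁅a, b⁆], by simp [commutator_mem_commutatorSet]⟩

theorem map (f : G →* G') (h : IsCommutatorProduct k g) : IsCommutatorProduct k (f g) := by
  obtain ⟨l, hl, hc, rfl⟩ := h
  refine ⟨l.map f, by simpa using hl, List.forall_mem_map.2 fun x hx => ?_,
    (map_list_prod f l).symm⟩
  obtain ⟨a, b, rfl⟩ := hc x hx
  exact ⟨f a, f b, (map_commutatorElement f a b).symm⟩

theorem conj (x : G) (h : IsCommutatorProduct k g) : IsCommutatorProduct k (x * g * x⁻¹) := by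
  simpa using h.map (MulAut.conj x).toMonoidHom

theorem inv (h : IsCommutatorProduct k g) : IsCommutatorProduct k g⁻¹ := by
  obtain ⟨l, hl, hc, rfl⟩ := h
  refine ⟨(l.map (·⁻¹)).reverse, by simpa, ?_, (List.prod_inv_reverse l).symm⟩
  simp only [List.mem_reverse, List.forall_mem_map]
  intro x hx
  obtain ⟨a, b, rfl⟩ := hc x hx
  exact ⟨b, a, (commutatorElement_inv a b).symm⟩

theorem exists_lift {f : G →* G'} (hf : Function.Surjective f) {y : G'}
    (h : IsCommutatorProduct k y) : ∃ x, f x = y ∧ IsCommutatorProduct k x := by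
  obtain ⟨l, hl, hc, rfl⟩ := h
  induction l generalizing k with
  | nil => exact ⟨1, by simp, one.mono k.zero_le⟩
  | cons y l ih =>
    obtain ⟨a', b', rfl⟩ := hc y (by simp)
    obtain ⟨a, rfl⟩ := hf a'
    obtain ⟨b, rfl⟩ := hf b'
    obtain ⟨x, hx, hxk⟩ := ih le_rfl fun z hz => hc z (List.mem_cons_of_mem _ hz)
    refine ⟨⁅a, b⁆ * x, by simp [hx, map_commutatorElement], ((of_commutator a b).mul hxk).mono ?_⟩
    simpa [add_comm] using hl

theorem mem_commutator (h : IsCommutatorProduct k g) : g ∈ commutator G := by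
  obtain ⟨l, -, hc, rfl⟩ := h
  rw [commutator_eq_closure]
  exact list_prod_mem fun x hx => Subgroup.subset_closure (hc x hx)

theorem exists_of_mem_commutator (hg : g ∈ commutator G) : ∃ k, IsCommutatorProduct k g := by
  rw [commutator_eq_closure] at hg
  induction hg using Subgroup.closure_induction with
  | mem x hx => obtain ⟨a, b, rfl⟩ := hx; exact ⟨1, of_commutator a b⟩
  | one => exact ⟨0, one⟩
  | mul x y _ _ hx hy => exact ⟨_, hx.choose_spec.mul hy.choose_spec⟩
  | inv x _ hx => exact ⟨_, hx.choose_spec.inv⟩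

theorem prod_mul_inv_of_perm {P Q : List G} (h : P.Perm Q) :
    IsCommutatorProduct P.length (P.prod * Q.prod⁻¹) := by
  induction P generalizing Q with
  | nil => simpa [List.nil_perm.1 h] using one
  | cons x P ih =>
    obtain ⟨Q₁, Q₂, rfl⟩ := List.append_of_mem (h.subset List.mem_cons_self)
    have hP : P.Perm (Q₁ ++ Q₂) := (h.trans List.perm_middle).cons_inv
    have hprod : (x :: P).prod * (Q₁ ++ x :: Q₂).prod⁻¹ =
        x * (P.prod * (Q₁ ++ Q₂).prod⁻¹) * x⁻¹ * ⁅x, Q₁.prod⁆ := by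
      simp only [List.prod_cons, List.prod_append, commutatorElement_def]
      group
    rw [hprod]
    exact ((ih hP).conj x).mul (of_commutator x Q₁.prod)

theorem commutatorLength_le (h : IsCommutatorProduct k g) : commutatorLength g ≤ k := by
  obtain ⟨l, hl, hc, hp⟩ := h
  exact le_trans (Nat.sInf_le ⟨l, rfl, hc, hp⟩) hl

end IsCommutatorProduct

variable {g h : G}

theorem isCommutatorProduct_commutatorLength (hg : g ∈ commutator G) :
    IsCommutatorProduct (commutatorLength g) g := by
  obtain ⟨-, l, -, hc, hp⟩ := IsCommutatorProduct.exists_of_mem_commutator hg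
  obtain ⟨l, hl, hc, hp⟩ := Nat.sInf_mem (s := {n | ∃ l : List G, l.length = n ∧
    (∀ x ∈ l, x ∈ commutatorSet G) ∧ l.prod = g}) ⟨_, l, rfl, hc, hp⟩
  exact ⟨l, hl.le, hc, hp⟩

theorem commutatorLength_mul_le (hg : g ∈ commutator G) (hh : h ∈ commutator G) :
    commutatorLength (g * h) ≤ commutatorLength g + commutatorLength h :=
  ((isCommutatorProduct_commutatorLength hg).mul
    (isCommutatorProduct_commutatorLength hh)).commutatorLength_le

theorem commutatorLength_map_le (f : G →* G') (hg : g ∈ commutator G) :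
    commutatorLength (f g) ≤ commutatorLength g :=
  ((isCommutatorProduct_commutatorLength hg).map f).commutatorLength_le

theorem map_mem_commutator (f : G →* G') (hg : g ∈ commutator G) : f g ∈ commutator G' :=
  ((isCommutatorProduct_commutatorLength hg).map f).mem_commutator

theorem exists_mem_commutator_commutatorLength_le {f : G →* G'} (hf : Function.Surjective f)
    {y : G'} (hy : y ∈ commutator G') :
    ∃ x ∈ commutator G, f x = y ∧ commutatorLength x ≤ commutatorLength y := by
  obtain ⟨x, hx, hxy⟩ := (isCommutatorProduct_commutatorLength hy).exists_lift hf
  exact ⟨x, hxy.mem_commutator, hx, hxy.commutatorLength_le⟩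

theorem subadditive_commutatorLength_pow (hg : g ∈ commutator G) :
    Subadditive fun n : ℕ => (commutatorLength (g ^ n) : ℝ) := fun m n => by
  beta_reduce
  rw [pow_add]
  exact_mod_cast commutatorLength_mul_le (pow_mem hg m) (pow_mem hg n)

theorem bddBelow_commutatorLength_pow_div (g : G) :
    BddBelow (Set.range fun n : ℕ => (commutatorLength (g ^ n) : ℝ) / n) :=
  ⟨0, Set.forall_mem_range.2 fun n => by positivity⟩

theorem tendsto_scl (hg : g ∈ commutator G) :
    Tendsto (fun n : ℕ => (commutatorLength (g ^ n) : ℝ) / n) atTop (𝓝 (scl g)) :=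
  tendsto_nhds_limUnder ⟨_, (subadditive_commutatorLength_pow hg).tendsto_lim
    (bddBelow_commutatorLength_pow_div g)⟩

theorem scl_le_div (hg : g ∈ commutator G) {n : ℕ} (hn : n ≠ 0) :
    scl g ≤ commutatorLength (g ^ n) / n := by
  have hsub := subadditive_commutatorLength_pow hg
  have hbdd := bddBelow_commutatorLength_pow_div g
  rw [tendsto_nhds_unique (tendsto_scl hg) (hsub.tendsto_lim hbdd)]
  exact hsub.lim_le_div hbdd hn

theorem scl_nonneg (hg : g ∈ commutator G) : 0 ≤ scl g :=
  ge_of_tendsto' (tendsto_scl hg) fun _ => by positivity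

theorem scl_le_commutatorLength (hg : g ∈ commutator G) : scl g ≤ commutatorLength g := by
  simpa using scl_le_div hg one_ne_zero

theorem scl_pow (hg : g ∈ commutator G) {n : ℕ} (hn : n ≠ 0) : scl (g ^ n) = n * scl g := by
  refine tendsto_nhds_unique (tendsto_scl (pow_mem hg n)) ?_
  have hlim := ((tendsto_scl hg).comp (tendsto_id.const_mul_atTop' hn.bot_lt)).const_mul (n : ℝ)
  refine hlim.congr fun k => ?_
  simp only [Function.comp_apply, id_eq, Nat.cast_mul, pow_mul]
  field_simp

theorem scl_mul_le_of_commute (hgh : Commute g h) (hg : g ∈ commutator G)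
    (hh : h ∈ commutator G) : scl (g * h) ≤ scl g + scl h := by
  refine le_of_tendsto_of_tendsto' (tendsto_scl (mul_mem hg hh))
    ((tendsto_scl hg).add (tendsto_scl hh)) fun n => ?_
  rw [← add_div, hgh.mul_pow]
  gcongr
  exact_mod_cast commutatorLength_mul_le (pow_mem hg n) (pow_mem hh n)

theorem scl_map_le (f : G →* G') (hg : g ∈ commutator G) : scl (f g) ≤ scl g := by
  refine le_of_tendsto_of_tendsto' (tendsto_scl (map_mem_commutator f hg)) (tendsto_scl hg)
    fun n => ?_
  rw [← map_pow]
  gcongr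
  exact commutatorLength_map_le f (pow_mem hg n)

theorem scl_map_eq {f : G →* G'} (hf : Function.Surjective f) (hcenter : f.ker ≤ Subgroup.center G)
    (hker : ∀ x ∈ f.ker, x ∈ commutator G → scl x = 0) (hg : g ∈ commutator G) :
    scl (f g) = scl g := by
  refine le_antisymm (scl_map_le f hg) (ge_of_tendsto (tendsto_scl (map_mem_commutator f hg)) ?_)
  filter_upwards [eventually_gt_atTop 0] with n hn
  obtain ⟨x, hx, hfx, hle⟩ :=
    exists_mem_commutator_commutatorLength_le hf (pow_mem (map_mem_commutator f hg) n)
  have hz_ker : x⁻¹ * g ^ n ∈ f.ker := by simp [MonoidHom.mem_ker, hfx]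
  have hz : x⁻¹ * g ^ n ∈ commutator G := mul_mem (inv_mem hx) (pow_mem hg n)
  have hcomm : Commute x (x⁻¹ * g ^ n) := Subgroup.mem_center_iff.1 (hcenter hz_ker) x
  rw [le_div_iff₀ (by positivity), mul_comm]
  calc n * scl g = scl (x * (x⁻¹ * g ^ n)) := by rw [mul_inv_cancel_left, scl_pow hg hn.ne']
    _ ≤ scl x + scl (x⁻¹ * g ^ n) := scl_mul_le_of_commute hcomm hx hz
    _ ≤ commutatorLength x := by
      rw [hker _ hz_ker hz, add_zero]; exact scl_le_commutatorLength hx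
    _ ≤ commutatorLength (f g ^ n) := mod_cast hle

theorem scl_image_commutator_eq {f : G →* G'} (hf : Function.Surjective f)
    (hcenter : f.ker ≤ Subgroup.center G)
    (hker : ∀ x ∈ f.ker, x ∈ commutator G → scl x = 0) :
    scl '' (commutator G : Set G) = scl '' (commutator G' : Set G') := by
  ext t
  constructor
  · rintro ⟨g, hg, rfl⟩
    exact ⟨f g, map_mem_commutator f hg, scl_map_eq hf hcenter hker hg⟩
  · rintro ⟨y, hy, rfl⟩
    obtain ⟨g, hg, rfl, -⟩ := exists_mem_commutator_commutatorLength_le hf hy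
    exact ⟨g, hg, (scl_map_eq hf hcenter hker hg).symm⟩

end CommutatorLength

section BarChains

variable {G : Type*} [Group G]

/-- The boundary of inhomogeneous bar 2-chains with trivial coefficients,
`(g, h) ↦ g + h - gh`. -/
noncomputable def barBoundary (R : Type*) [Ring R] : (G × G →₀ R) →ₗ[R] (G →₀ R) :=
  Finsupp.lmapDomain R R Prod.fst + Finsupp.lmapDomain R R Prod.snd -
    Finsupp.lmapDomain R R fun x => x.1 * x.2

theorem barBoundary_single {R : Type*} [Ring R] (x : G × G) (r : R) :
    barBoundary R (Finsupp.single x r) =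
      Finsupp.single x.1 r + Finsupp.single x.2 r - Finsupp.single (x.1 * x.2) r := by
  simp [barBoundary]

theorem barBoundary_mapRange {R S : Type*} [Ring R] [Ring S] (f : R →+ S) (w : G × G →₀ R) :
    barBoundary S (Finsupp.mapRange.addMonoidHom f w) =
      Finsupp.mapRange.addMonoidHom f (barBoundary R w) := by
  induction w using Finsupp.induction_linear with
  | zero => simp
  | add u v hu hv => simp only [map_add, hu, hv]
  | single x r => simp [barBoundary_single, map_add, map_sub]

end BarChains

section IntegralFillings

/-- The integral chain of a word: the coefficient of `x` is the number of occurrences of `x`. -/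
noncomputable def wordChain {α : Type*} (l : List α) : α →₀ ℤ :=
  (l.map fun x => Finsupp.single x 1).sum

@[simp]
theorem wordChain_append {α : Type*} (l l' : List α) :
    wordChain (l ++ l') = wordChain l + wordChain l' := by
  simp [wordChain]

@[simp]
theorem wordChain_flatten_replicate {α : Type*} (n : ℕ) (l : List α) :
    wordChain (List.replicate n l).flatten = n • wordChain l := by
  induction n with
  | zero => simp [wordChain]
  | succ n ih => rw [List.replicate_succ, List.flatten_cons, wordChain_append, ih, succ_nsmul']

theorem wordChain_apply {α : Type*} [DecidableEq α] (l : List α) (a : α) :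
    wordChain l a = l.count a := by
  induction l with
  | nil => rfl
  | cons x l ih =>
    rw [← List.singleton_append, wordChain_append, Finsupp.add_apply, ih]
    simp [wordChain, List.count_cons, Finsupp.single_apply, add_comm]

theorem perm_of_wordChain_eq {α : Type*} {P Q : List α} (h : wordChain P = wordChain Q) :
    P.Perm Q := by
  classical
  refine List.perm_iff_count.2 fun a => ?_
  exact_mod_cast (wordChain_apply P a).symm.trans
    ((DFunLike.congr_fun h a).trans (wordChain_apply Q a))

variable {G : Type*} [Group G]

theorem exists_words_barBoundary_single (x : G × G) (n : ℤ) : ∃ R S : List G,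
    R.prod = S.prod ∧ wordChain R + barBoundary ℤ (Finsupp.single x n) = wordChain S ∧
      R.length ≤ 2 * n.natAbs := by
  have hx : barBoundary ℤ (Finsupp.single x n) =
      n • (wordChain [x.1, x.2] - wordChain [x.1 * x.2]) := by
    simp [barBoundary_single, wordChain, smul_sub, smul_add]
  obtain ⟨k, rfl | rfl⟩ := n.eq_nat_or_neg
  · refine ⟨(List.replicate k [x.1 * x.2]).flatten, (List.replicate k [x.1, x.2]).flatten,
      by simp [List.prod_flatten], ?_, by simp; omega⟩
    rw [hx, wordChain_flatten_replicate, wordChain_flatten_replicate]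
    module
  · refine ⟨(List.replicate k [x.1, x.2]).flatten, (List.replicate k [x.1 * x.2]).flatten,
      by simp [List.prod_flatten], ?_, by simp; omega⟩
    rw [hx, wordChain_flatten_replicate, wordChain_flatten_replicate]
    module

theorem IsCommutatorProduct.prod_mul_inv_of_wordChain_eq {P Q : List G} {w : G × G →₀ ℤ}
    (h : wordChain P = wordChain Q + barBoundary ℤ w) :
    IsCommutatorProduct (P.length + 2 * w.sum fun _ n => n.natAbs) (P.prod * Q.prod⁻¹) := by
  classical
  induction w using Finsupp.induction generalizing P Q with
  | zero => simpa using prod_mul_inv_of_perm (perm_of_wordChain_eq (by simpa using h))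
  | single_add x n w hx _ ih =>
    have hnorm : (Finsupp.single x n + w).sum (fun _ n => n.natAbs) =
        n.natAbs + w.sum fun _ n => n.natAbs := by
      rw [Finsupp.sum_add_index_of_disjoint, Finsupp.sum_single_index (by simp)]
      exact (Finset.disjoint_singleton_left.2 hx).mono_left Finsupp.support_single_subset
    obtain ⟨R, S, hprod, hRS, hlen⟩ := exists_words_barBoundary_single x n
    have hPR : wordChain (P ++ R) = wordChain (Q ++ S) + barBoundary ℤ w := by
      rw [wordChain_append, wordChain_append, h, ← hRS, map_add]
      abel
    have := ih hPR
    rw [List.prod_append, List.prod_append, hprod, mul_inv_rev, mul_assoc,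
      mul_inv_cancel_left] at this
    refine this.mono ?_
    rw [hnorm, List.length_append]
    omega

theorem isCommutatorProduct_of_barBoundary_eq {x : G} {N : ℕ} {w : G × G →₀ ℤ}
    (hw : barBoundary ℤ w = Finsupp.single x (N : ℤ)) :
    IsCommutatorProduct (N + 2 * w.sum fun _ n => n.natAbs) (x ^ N) := by
  have h : wordChain (List.replicate N x) = wordChain [] + barBoundary ℤ w := by
    simp [wordChain, hw]
  simpa using IsCommutatorProduct.prod_mul_inv_of_wordChain_eq h

end IntegralFillings

section RationalApproximation

-- `f` moves the elements of a Hamel basis to nearby rational numbers.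
theorem exists_ratLinear_mem_of_isOpen {U : Set (ℝ → ℝ)} (hU : IsOpen U) (hid : id ∈ U) :
    ∃ f : ℝ →ₗ[ℚ] ℚ, (fun t => (f t : ℝ)) ∈ U := by
  let b := Module.Basis.ofVectorSpace ℚ ℝ
  let Φ : (Module.Basis.ofVectorSpaceIndex ℚ ℝ → ℝ) → ℝ → ℝ := fun v t =>
    Finsupp.linearCombination ℚ v (b.repr t)
  have hΦ : Continuous Φ := by
    simp only [Φ, Finsupp.linearCombination_apply, Finsupp.sum]
    fun_prop
  have hb : Φ b = id := funext b.linearCombination_repr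
  have hdense : DenseRange fun (q : Module.Basis.ofVectorSpaceIndex ℚ ℝ → ℚ) i => (q i : ℝ) :=
    DenseRange.piMap fun _ => Rat.denseRange_cast
  obtain ⟨q, hq⟩ := hdense.exists_mem_open (hU.preimage hΦ) ⟨b, by rwa [Set.mem_preimage, hb]⟩
  refine ⟨b.constr ℚ q, ?_⟩
  convert Set.mem_preimage.1 hq with t
  simp [Φ, Module.Basis.constr_apply, Finsupp.linearCombination_apply, Finsupp.sum, Rat.smul_def]

theorem exists_pos_forall_mul_eq_intCast (s : Finset ℚ) :
    ∃ N : ℕ, 0 < N ∧ ∀ q ∈ s, ∃ n : ℤ, N * q = n := by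
  refine ⟨∏ q ∈ s, q.den, Finset.prod_pos fun q _ => q.den_pos, fun q hq => ?_⟩
  obtain ⟨k, hk⟩ := Finset.dvd_prod_of_mem Rat.den hq
  refine ⟨k * q.num, ?_⟩
  rw [hk, Int.cast_mul, ← Rat.den_mul_eq_num]
  push_cast
  ring

theorem exists_ratLinear_sum_abs_lt {ι : Type*} (s : Finset ι) (a : ι → ℝ) {K : ℕ}
    (hK : ∑ i ∈ s, |a i| < K) : ∃ f : ℝ →ₗ[ℚ] ℚ, (∃ n : ℤ, f 1 = n) ∧
      (∀ i ∈ s, ∃ n : ℤ, f (a i) = n) ∧ ∑ i ∈ s, |f (a i)| < K * f 1 := by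
  classical
  have hopen : IsOpen {u : ℝ → ℝ | ∑ i ∈ s, |u (a i)| < K * u 1} :=
    isOpen_lt (by fun_prop) (by fun_prop)
  obtain ⟨f, hf⟩ := exists_ratLinear_mem_of_isOpen hopen (by simpa using hK)
  have hlt : ∑ i ∈ s, |f (a i)| < K * f 1 := by
    have : ∑ i ∈ s, |(f (a i) : ℝ)| < K * (f 1 : ℝ) := hf
    exact_mod_cast this
  obtain ⟨N, hN, hint⟩ := exists_pos_forall_mul_eq_intCast (insert (f 1) (s.image (f ∘ a)))
  refine ⟨(N : ℚ) • f, hint _ (by simp), fun i hi => hint _ ?_, ?_⟩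
  · exact Finset.mem_insert_of_mem (Finset.mem_image_of_mem (f ∘ a) hi)
  · have hN : (0 : ℚ) < N := by exact_mod_cast hN
    simp only [LinearMap.smul_apply, smul_eq_mul, abs_mul, Nat.abs_cast, ← Finset.mul_sum]
    rw [mul_left_comm]
    exact mul_lt_mul_of_pos_left hlt hN

variable {G : Type*} [Group G]

theorem exists_integral_filling {x : G} {w : G × G →₀ ℝ}
    (hw : barBoundary ℝ w = Finsupp.single x 1) {K : ℕ} (hK : (w.sum fun _ t => |t|) < K) :
    ∃ (N : ℕ) (w' : G × G →₀ ℤ), 0 < N ∧ barBoundary ℤ w' = Finsupp.single x (N : ℤ) ∧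
      (w'.sum fun _ n => n.natAbs) ≤ K * N := by
  obtain ⟨f, ⟨m, hm⟩, hint, hlt⟩ := exists_ratLinear_sum_abs_lt w.support w hK
  have hm_pos : (0 : ℚ) < m := by
    rw [← hm]
    exact pos_of_mul_pos_right ((Finset.sum_nonneg fun _ _ => abs_nonneg _).trans_lt hlt)
      (Nat.cast_nonneg K)
  lift m to ℕ using by exact_mod_cast hm_pos.le
  let w' : G × G →₀ ℤ := w.mapRange (fun t => ⌊f t⌋) (by simp)
  have hw'_apply (y) : ((w' y : ℤ) : ℚ) = f (w y) := by
    by_cases hy : y ∈ w.support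
    · obtain ⟨n, hn⟩ := hint y hy
      simp [w', hn]
    · simp [w', Finsupp.notMem_support_iff.1 hy]
  have hw' : Finsupp.mapRange.addMonoidHom (Int.castAddHom ℚ) w' =
      Finsupp.mapRange.addMonoidHom f.toAddMonoidHom w := by
    ext y
    simpa using hw'_apply y
  refine ⟨m, w', by exact_mod_cast hm_pos, ?_, ?_⟩
  · refine Finsupp.mapRange_injective (Int.castAddHom ℚ) (map_zero _) Int.cast_injective ?_
    change Finsupp.mapRange.addMonoidHom (Int.castAddHom ℚ) _ =
      Finsupp.mapRange.addMonoidHom (Int.castAddHom ℚ) _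
    rw [← barBoundary_mapRange, hw', barBoundary_mapRange, hw]
    simp [hm]
  · have hsupport : w'.support ⊆ w.support := Finsupp.support_mapRange
    rw [Finsupp.sum_of_support_subset _ hsupport _ (by simp)]
    simp only [← hw'_apply, hm, Int.cast_natCast] at hlt
    qify
    simpa [Nat.cast_natAbs] using hlt.le

end RationalApproximation

section BavardDuality

open Filter Topology

theorem exists_dual_apply_le_seminorm {V W : Type*} [AddCommGroup V] [Module ℝ V]
    [AddCommGroup W] [Module ℝ W] (p : Seminorm ℝ V) (d : V →ₗ[ℝ] W) {x : W} (hx : x ≠ 0)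
    (hxd : x ∈ LinearMap.range d) {K : ℝ} (hK₀ : 0 ≤ K) (hK : ∀ v, d v = x → K ≤ p v) :
    ∃ F : Module.Dual ℝ W, F x = K ∧ ∀ v, F (d v) ≤ p v := by
  obtain ⟨w, hw⟩ := hxd
  obtain ⟨g, hgx⟩ : ∃ g : Module.Dual ℝ W, g x = K := by
    obtain ⟨g, hg⟩ := not_forall.1 (mt (Module.forall_dual_apply_eq_zero_iff ℝ x).1 hx)
    exact ⟨(K / g x) • g, by simp [hg]⟩
  obtain ⟨F, hFg, hFp⟩ := exists_extension_of_le_sublinear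
    ((g ∘ₗ d).toPMap ((Submodule.span ℝ {x}).comap d)) p
    (fun c hc v => by rw [map_smul_eq_mul, Real.norm_of_nonneg hc.le]) (map_add_le_add p) (by
      rintro ⟨v, hv⟩
      obtain ⟨c, hc⟩ := Submodule.mem_span_singleton.1 hv
      change g (d v) ≤ p v
      rw [← hc, map_smul, hgx, smul_eq_mul]
      rcases le_or_gt c 0 with hc0 | hc0
      · exact (mul_nonpos_of_nonpos_of_nonneg hc0 hK₀).trans (apply_nonneg p v)
      · have h := hK (c⁻¹ • v) (by rw [map_smul, ← hc, inv_smul_smul₀ hc0.ne'])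
        rwa [map_smul_eq_mul, norm_inv, Real.norm_of_nonneg hc0.le, le_inv_mul_iff₀ hc0] at h)
  have hker : F ∈ (LinearMap.ker d).dualAnnihilator := by
    rw [Submodule.mem_dualAnnihilator]
    intro v hv
    have := hFg ⟨v, by simp [LinearMap.mem_ker.1 hv]⟩
    simpa [LinearMap.mem_ker.1 hv] using this
  rw [← LinearMap.range_dualMap_eq_dualAnnihilator_ker] at hker
  obtain ⟨F', rfl⟩ := hker
  refine ⟨F', ?_, hFp⟩
  have := hFg ⟨w, by simp [hw, Submodule.mem_span_singleton_self]⟩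
  simpa [hw, hgx] using this

/-- The `ℓ¹`-norm of finitely supported real functions. -/
noncomputable def l1Seminorm (α : Type*) : Seminorm ℝ (α →₀ ℝ) :=
  Seminorm.of (fun w => w.sum fun _ t => |t|)
    (fun u v => by
      classical
      rw [Finsupp.sum_of_support_subset (u + v) Finsupp.support_add _ (by simp),
        Finsupp.sum_of_support_subset u Finset.subset_union_left _ (by simp),
        Finsupp.sum_of_support_subset v Finset.subset_union_right _ (by simp),
        ← Finset.sum_add_distrib]
      exact Finset.sum_le_sum fun y _ => abs_add_le _ _)
    (fun c w => by
      rw [Finsupp.sum_smul_index (by simp), Finsupp.mul_sum]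
      simp [abs_mul])

theorem l1Seminorm_apply {α : Type*} (w : α →₀ ℝ) : l1Seminorm α w = w.sum fun _ t => |t| := rfl

variable {G : Type*} [Group G]

theorem exists_real_filling {x : G} (hx : ∀ χ : Additive G →+ ℝ, χ (Additive.ofMul x) = 0) :
    Finsupp.single x 1 ∈ LinearMap.range (barBoundary (G := G) ℝ) := by
  by_contra hcon
  obtain ⟨F, hFx, hF⟩ := Submodule.exists_le_ker_of_notMem hcon
  refine hFx (hx (AddMonoidHom.mk' (fun g => F (Finsupp.single g.toMul 1)) fun a b => ?_))
  have h := LinearMap.mem_ker.1 (hF ⟨Finsupp.single (a.toMul, b.toMul) 1, rfl⟩)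
  rw [barBoundary_single, map_sub, map_add, sub_eq_zero] at h
  exact h.symm

theorem exists_apply_eq_of_forall_le_filling {x : G}
    (hx : Finsupp.single x 1 ∈ LinearMap.range (barBoundary (G := G) ℝ)) {K : ℝ}
    (hK₀ : 0 ≤ K) (hK : ∀ w, barBoundary ℝ w = Finsupp.single x 1 → K ≤ l1Seminorm _ w) :
    ∃ f : G → ℝ, (∀ a b, |f (a * b) - f a - f b| ≤ 1) ∧ f x = K := by
  obtain ⟨F, hFx, hF⟩ := exists_dual_apply_le_seminorm _ _ (by simp) hx hK₀ hK
  refine ⟨fun g => F (Finsupp.single g 1), fun a b => ?_, hFx⟩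
  have hpos := hF (Finsupp.single (a, b) 1)
  have hneg := hF (-Finsupp.single (a, b) 1)
  rw [map_neg, map_neg, map_neg_eq_map (l1Seminorm (G × G))] at hneg
  simp only [barBoundary_single, map_sub, map_add, l1Seminorm_apply, abs_zero,
    Finsupp.sum_single_index, abs_one] at hpos hneg
  rw [abs_le]
  constructor <;> linarith

theorem abs_apply_pow_sub_le {f : G → ℝ} {D : ℝ} (hf : ∀ a b, |f (a * b) - f a - f b| ≤ D)
    (x : G) (n : ℕ) : |f (x ^ (n + 1)) - (n + 1) * f x| ≤ n * D := by
  induction n with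
  | zero => simp
  | succ n ih =>
    have h := hf (x ^ (n + 1)) x
    rw [pow_succ _ (n + 1)]
    rw [abs_le] at *
    push_cast
    constructor <;> linarith

variable {h : G}

theorem apply_ofMul_eq_zero_of_mem_commutator {A : Type*} [AddCommGroup A] (χ : Additive G →+ A)
    (hh : h ∈ commutator G) : χ (Additive.ofMul h) = 0 :=
  Abelianization.commutator_subset_ker (AddMonoidHom.toMultiplicativeRight χ) hh

theorem exists_filling_lt (hh : h ∈ commutator G)
    (hbdd : ∀ f ∈ quasimorphisms G, ∃ C : ℝ, ∀ n : ℕ, |f (h ^ n)| ≤ C) {K : ℝ}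
    (hK : 1 < K) (n : ℕ) :
    ∃ w, barBoundary ℝ w = Finsupp.single (h ^ n) 1 ∧ l1Seminorm _ w < K := by
  by_contra! hcon
  have hfill := exists_real_filling (x := h ^ n) fun χ =>
    apply_ofMul_eq_zero_of_mem_commutator χ (pow_mem hh n)
  obtain ⟨f, hf, hfx⟩ := exists_apply_eq_of_forall_le_filling hfill (by linarith) hcon
  obtain ⟨C, hC⟩ := hbdd f ⟨1, hf⟩
  obtain ⟨k, hk⟩ := exists_nat_gt (C / (K - 1))
  rw [div_lt_iff₀ (by linarith)] at hk
  have hpow := abs_apply_pow_sub_le hf (h ^ n) k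
  have hbound := hC (n * (k + 1))
  rw [hfx, ← pow_mul] at hpow
  rw [abs_le] at hpow hbound
  linarith

-- By Hahn-Banach, each `h ^ n` is the boundary of a real 2-chain of norm below `2`. A rational
-- approximation with denominator `N` then writes `h ^ (n * N)` as a product of at most `5 * N`
-- commutators.
theorem scl_eq_zero_of_forall_quasimorphism_bounded (hh : h ∈ commutator G)
    (hbdd : ∀ f ∈ quasimorphisms G, ∃ C : ℝ, ∀ n : ℕ, |f (h ^ n)| ≤ C) : scl h = 0 := by
  refine le_antisymm (ge_of_tendsto (tendsto_const_div_atTop_nhds_zero_nat 5) ?_) (scl_nonneg hh)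
  filter_upwards [eventually_gt_atTop 0] with n hn
  obtain ⟨w, hw, hlt⟩ := exists_filling_lt hh hbdd one_lt_two n
  obtain ⟨N, w', hN, hw', hle⟩ := exists_integral_filling hw (K := 2) (by exact_mod_cast hlt)
  have hcl : commutatorLength (h ^ (n * N)) ≤ 5 * N := by
    rw [pow_mul]
    exact ((isCommutatorProduct_of_barBoundary_eq hw').mono (by omega)).commutatorLength_le
  calc scl h ≤ commutatorLength (h ^ (n * N)) / (n * N : ℕ) := scl_le_div hh (by positivity)
    _ ≤ (5 * N : ℕ) / (n * N : ℕ) := by gcongr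
    _ = 5 / n := by push_cast; field_simp

end BavardDuality

section FinitePresentation

open Monoid

theorem normal_closure_of_conj_mem {G : Type*} [Group G] {X B : Set G}
    (hX : Subgroup.closure X = ⊤)
    (hconj : ∀ x ∈ X, ∀ b ∈ B, x * b * x⁻¹ ∈ Subgroup.closure B)
    (hconj' : ∀ x ∈ X, ∀ b ∈ B, x⁻¹ * b * x ∈ Subgroup.closure B) :
    (Subgroup.closure B).Normal := by
  have conj_mem {x : G} (hx : ∀ b ∈ B, x * b * x⁻¹ ∈ Subgroup.closure B) {y : G}
      (hy : y ∈ Subgroup.closure B) : x * y * x⁻¹ ∈ Subgroup.closure B :=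
    (Subgroup.closure_le ((Subgroup.closure B).comap (MulAut.conj x).toMonoidHom)).2 hx hy
  refine Subgroup.normalizer_eq_top_iff.1 (top_le_iff.1 ?_)
  rw [← hX, Subgroup.closure_le]
  refine fun x hx => Subgroup.mem_normalizer_iff.2 fun y => ⟨conj_mem (hconj x hx), fun hy => ?_⟩
  have := conj_mem (x := x⁻¹) (by simpa only [inv_inv] using hconj' x hx) hy
  simpa only [mul_assoc, inv_mul_cancel_left, inv_mul_cancel, inv_inv, mul_one] using this

instance {G : Type*} [Group G] [h : Group.IsFinitelyPresented G] : Group.FG G := by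
  obtain ⟨n, f, hf, -⟩ := h.out
  exact Group.fg_of_surjective hf

section Extension

variable {P N E G : Type*} [Group P] [Group N] [Group E] [Group G] (S : GroupExtension N E G)
  {l : P →* E}

theorem coprodLift_surjective (hl : Function.Surjective (S.rightHom.comp l)) :
    Function.Surjective (Coprod.lift l S.inl) := by
  intro e
  obtain ⟨x, hx⟩ := hl (S.rightHom e)
  obtain ⟨a, ha⟩ : (l x)⁻¹ * e ∈ S.inl.range := by
    rw [S.range_inl_eq_ker_rightHom, MonoidHom.mem_ker, map_mul, map_inv, ← hx]
    exact inv_mul_cancel _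
  exact ⟨Coprod.inl x * Coprod.inr a, by simp [ha]⟩

theorem ker_coprodLift_eq {M : Subgroup (Coprod P N)} [M.Normal]
    [(M ⊔ (Coprod.inr : N →* Coprod P N).range).Normal] (hM : M ≤ (Coprod.lift l S.inl).ker)
    (hker : (S.rightHom.comp l).ker.map Coprod.inl ≤ M ⊔ (Coprod.inr : N →* Coprod P N).range) :
    (Coprod.lift l S.inl).ker = M := by
  refine le_antisymm (fun k hk => ?_) hM
  set L := M ⊔ (Coprod.inr : N →* Coprod P N).range with hL
  have rightHom_eq_one {y : Coprod P N} (hy : y ∈ L) : S.rightHom (Coprod.lift l S.inl y) = 1 := by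
    obtain ⟨m, hm, _, ⟨a, rfl⟩, rfl⟩ := Subgroup.mem_sup_of_normal_left.1 hy
    rw [map_mul, MonoidHom.mem_ker.1 (hM hm), one_mul, Coprod.lift_apply_inr, S.rightHom_inl]
  have hk_mem : k ∈ L := by
    have htop : (Coprod.inl : P →* Coprod P N).range ⊔ L = ⊤ := by
      rw [hL, sup_left_comm, Coprod.range_inl_sup_range_inr, sup_top_eq]
    obtain ⟨_, ⟨x, rfl⟩, y, hy, rfl⟩ :=
      Subgroup.mem_sup_of_normal_right.1 (htop ▸ Subgroup.mem_top k)
    have hx : x ∈ (S.rightHom.comp l).ker := by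
      have h := congrArg S.rightHom (MonoidHom.mem_ker.1 hk)
      rwa [map_mul, map_mul, rightHom_eq_one hy, mul_one, Coprod.lift_apply_inl, map_one] at h
    exact L.mul_mem (hker (Subgroup.mem_map_of_mem _ hx)) hy
  obtain ⟨m, hm, _, ⟨a, rfl⟩, rfl⟩ := Subgroup.mem_sup_of_normal_left.1 hk_mem
  have ha : S.inl a = 1 := by
    rw [MonoidHom.mem_ker, map_mul, MonoidHom.mem_ker.1 (hM hm), one_mul] at hk
    exact hk
  rwa [(map_eq_one_iff _ S.inl_injective).1 ha, map_one, mul_one]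

end Extension

section Relators

variable {P N : Type*} [Group P] [Group N] {X : Set P} {A : Set N}

theorem normal_sup_range_inr {M : Subgroup (Coprod P N)} [hM : M.Normal]
    (hX : Subgroup.closure X = ⊤) (hX_inv : ∀ x ∈ X, x⁻¹ ∈ X) (hA : Subgroup.closure A = ⊤)
    (hXA : ∀ x ∈ X, ∀ a ∈ A, ∃ b,
      Coprod.inl x * Coprod.inr a * (Coprod.inl x)⁻¹ * (Coprod.inr b)⁻¹ ∈ M) :
    (M ⊔ (Coprod.inr : N →* Coprod P N).range).Normal := by
  set B : Set (Coprod P N) := M ∪ Coprod.inr '' A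
  have hB : M ⊔ (Coprod.inr : N →* Coprod P N).range = Subgroup.closure B := by
    rw [Subgroup.closure_union, Subgroup.closure_eq, ← MonoidHom.map_closure, hA,
      MonoidHom.range_eq_map]
  have inr_mem (a : N) : Coprod.inr a ∈ Subgroup.closure B :=
    hB ▸ Subgroup.mem_sup_right ⟨a, rfl⟩
  have mem_of_mem {m : Coprod P N} (hm : m ∈ M) : m ∈ Subgroup.closure B :=
    hB ▸ Subgroup.mem_sup_left hm
  have hconj : ∀ x ∈ Coprod.inl '' X ∪ Set.range (Coprod.inr : N →* Coprod P N), ∀ b ∈ B,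
      x * b * x⁻¹ ∈ Subgroup.closure B := by
    rintro x hx b (hb | ⟨a, ha, rfl⟩)
    · exact mem_of_mem (hM.conj_mem b hb x)
    · obtain ⟨y, hy, rfl⟩ | ⟨c, rfl⟩ := hx
      · obtain ⟨d, hd⟩ := hXA y hy a ha
        simpa using mul_mem (mem_of_mem hd) (inr_mem d)
      · exact mul_mem (mul_mem (inr_mem c) (inr_mem a)) (inv_mem (inr_mem c))
  rw [hB]
  refine normal_closure_of_conj_mem (X := Coprod.inl '' X ∪ Set.range Coprod.inr) ?_ hconj ?_
  · rw [Subgroup.closure_union, ← MonoidHom.map_closure, hX, ← MonoidHom.coe_range,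
      Subgroup.closure_eq, ← MonoidHom.range_eq_map, Coprod.range_inl_sup_range_inr]
  · rintro x hx b hb
    have hx_inv : x⁻¹ ∈ Coprod.inl '' X ∪ Set.range (Coprod.inr : N →* Coprod P N) := by
      obtain ⟨y, hy, rfl⟩ | ⟨c, rfl⟩ := hx
      · exact Or.inl ⟨y⁻¹, hX_inv y hy, map_inv _ _⟩
      · exact Or.inr ⟨c⁻¹, map_inv _ _⟩
    simpa only [inv_inv] using hconj _ hx_inv b hb

end Relators

theorem isFinitelyNormallyGenerated_ker_coprodLift {P N E G : Type*} [Group P] [Group N]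
    [Group E] [Group G] [Group.FG P] [Group.FG N] (S : GroupExtension N E G) {l : P →* E}
    (hker : (S.rightHom.comp l).ker.IsFinitelyNormallyGenerated) :
    (Coprod.lift l S.inl).ker.IsFinitelyNormallyGenerated := by
  obtain ⟨X, hX, hX_fin⟩ := Group.fg_iff.1 (inferInstance : Group.FG P)
  obtain ⟨A, hA, hA_fin⟩ := Group.fg_iff.1 (inferInstance : Group.FG N)
  obtain ⟨R, hR_fin, hR⟩ := hker
  have hcorr (r : P) (hr : r ∈ R) : ∃ a, S.inl a = l r := by
    rw [← MonoidHom.mem_range, S.range_inl_eq_ker_rightHom]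
    exact hR.le (Subgroup.subset_normalClosure hr)
  choose! c hc using hcorr
  set T : Set (Coprod P N) := (fun r => Coprod.inl r * (Coprod.inr (c r))⁻¹) '' R ∪
    (fun x : P × N => Coprod.inl x.1 * Coprod.inr x.2 * (Coprod.inl x.1)⁻¹ *
      (Coprod.inr (S.conjAct (l x.1) x.2))⁻¹) '' ((X ∪ X⁻¹) ×ˢ A)
  have : (Subgroup.normalClosure T ⊔ (Coprod.inr : N →* Coprod P N).range).Normal := by
    refine normal_sup_range_inr (X := X ∪ X⁻¹) (top_le_iff.1 ?_) (fun x hx => ?_) hA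
      fun x hx a ha => ⟨_, Subgroup.subset_normalClosure (Or.inr ⟨(x, a), ⟨hx, ha⟩, rfl⟩)⟩
    · exact hX ▸ Subgroup.closure_mono Set.subset_union_left
    · simpa [or_comm] using hx
  refine ⟨T, (hR_fin.image _).union ((((hX_fin.union hX_fin.inv).prod hA_fin)).image _),
    (ker_coprodLift_eq S (Subgroup.normalClosure_le_normal ?_) ?_).symm⟩
  · rintro _ (⟨r, hr, rfl⟩ | ⟨⟨x, a⟩, -, rfl⟩)
    · simp [MonoidHom.mem_ker, hc r hr]
    · simp [MonoidHom.mem_ker, S.inl_conjAct_comm]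
  · rw [← hR, Subgroup.map_le_iff_le_comap]
    refine Subgroup.normalClosure_le_normal fun r hr => ?_
    have hrel := Subgroup.subset_normalClosure (s := T) (Or.inl ⟨r, hr, rfl⟩)
    have hcr : (Coprod.inr (c r) : Coprod P N) ∈ (Coprod.inr : N →* Coprod P N).range := ⟨c r, rfl⟩
    simpa using mul_mem (Subgroup.mem_sup_left hrel) (Subgroup.mem_sup_right hcr)

theorem isFinitelyPresented_of_groupExtension {N E G : Type*} [Group N] [Group E] [Group G]
    (S : GroupExtension N E G) [Group.IsFinitelyPresented N] [hG : Group.IsFinitelyPresented G] :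
    Group.IsFinitelyPresented E := by
  obtain ⟨n, π, hπ, hker⟩ := hG.out
  obtain ⟨l, rfl⟩ : ∃ l : FreeGroup (Fin n) →* E, S.rightHom.comp l = π :=
    ⟨FreeGroup.lift fun i => Function.surjInv S.rightHom_surjective (π (FreeGroup.of i)),
      FreeGroup.ext_hom _ _ fun i => by simp [Function.surjInv_eq]⟩
  exact .of_surjective (Coprod.lift l S.inl) (coprodLift_surjective S hπ)
    (isFinitelyNormallyGenerated_ker_coprodLift S hker)

theorem isFinitelyPresented_prod (G H : Type*) [Group G] [Group H] [Group.IsFinitelyPresented G]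
    [Group.IsFinitelyPresented H] : Group.IsFinitelyPresented (G × H) :=
  isFinitelyPresented_of_groupExtension (N := G) (G := H)
    { inl := MonoidHom.inl G H
      rightHom := MonoidHom.snd G H
      inl_injective := fun _ _ h => congrArg Prod.fst h
      range_inl_eq_ker_rightHom := by
        ext ⟨g, h⟩
        simpa [MonoidHom.ker_snd, Subgroup.mem_prod] using eq_comm
      rightHom_surjective := Prod.snd_surjective }

theorem isFinitelyPresented_multiplicative_pi (n : ℕ) :
    Group.IsFinitelyPresented (Multiplicative (Fin n → ℤ)) := by
  induction n with
  | zero => infer_instance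
  | succ n ih =>
    have := isFinitelyPresented_prod (Multiplicative ℤ) (Multiplicative (Fin n → ℤ))
    exact .equiv ((MulEquiv.prodMultiplicative _ _).symm.trans
      (Fin.consLinearEquiv ℤ fun _ => ℤ).toAddEquiv.toMultiplicative)

theorem isFinitelyPresented_multiplicative_of_finite (A : Type*) [AddCommGroup A]
    [Module ℤ A] [Module.Finite ℤ A] : Group.IsFinitelyPresented (Multiplicative A) := by
  obtain ⟨n, f, hf⟩ := Module.Finite.exists_fin' ℤ A
  have := isFinitelyPresented_multiplicative_pi n
  have : Group.FG (AddMonoidHom.toMultiplicative f.toAddMonoidHom).ker :=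
    AddGroup.fg_iff_mul_fg.1 (Module.Finite.iff_addGroup_fg.1
      (inferInstance : Module.Finite ℤ (LinearMap.ker f)))
  exact .of_surjective (AddMonoidHom.toMultiplicative f.toAddMonoidHom) hf (.of_FG _)

end FinitePresentation

section FreeSubmodules

variable {ι R : Type*}

theorem finsupp_eq_zero_or_mem_supported_Iic [LinearOrder ι] [Semiring R] (x : ι →₀ R) :
    x = 0 ∨ ∃ i ∈ x.support, x ∈ Finsupp.supported R R (Set.Iic i) := by
  refine or_iff_not_imp_left.2 fun hx => ?_
  have hs := Finsupp.support_nonempty_iff.2 hx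
  exact ⟨_, Finset.max'_mem _ hs,
    (Finsupp.mem_supported R _).2 fun j hj => Finset.le_max' _ _ hj⟩

theorem apply_eq_zero_of_mem_supported_Iic [LinearOrder ι] [Semiring R] {x : ι →₀ R} {i j : ι}
    (hx : x ∈ Finsupp.supported R R (Set.Iic i)) (hij : i < j) : x j = 0 :=
  Finsupp.notMem_support_iff.1 fun hj => not_le.2 hij ((Finsupp.mem_supported R _).1 hx hj)

theorem linearIndepOn_of_mem_supported_Iic [LinearOrder ι] [Ring R] [NoZeroDivisors R]
    {v : ι → ι →₀ R} (hv : ∀ i, v i ∈ Finsupp.supported R R (Set.Iic i)) :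
    LinearIndepOn R v {i | v i i ≠ 0} := by
  rw [linearIndepOn_iff]
  intro l hl hl_zero
  obtain h | ⟨j, hj, hlj⟩ := finsupp_eq_zero_or_mem_supported_Iic l
  · exact h
  have hsum : l.sum (fun i a => a • v i) j = l j * v j j := by
    rw [Finsupp.sum_apply, Finsupp.sum, Finset.sum_eq_single_of_mem j hj, Finsupp.smul_apply,
      smul_eq_mul]
    intro i hi hij
    rw [Finsupp.smul_apply, apply_eq_zero_of_mem_supported_Iic (hv i)
      (lt_of_le_of_ne (hlj hi) hij), smul_zero]
  rw [← Finsupp.linearCombination_apply, hl_zero, Finsupp.zero_apply, eq_comm, mul_eq_zero] at hsum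
  exact absurd hsum (not_or.2 ⟨Finsupp.mem_support_iff.1 hj, hl hj⟩)

theorem le_span_of_forall_exists_apply_eq_mul [LinearOrder ι] [WellFoundedLT ι] [Ring R]
    {N : Submodule R (ι →₀ R)} {v : ι → ι →₀ R} (hv : ∀ i, v i ∈ Finsupp.supported R R (Set.Iic i))
    (hvN : ∀ i, v i ∈ N)
    (hgen : ∀ i, ∀ x ∈ N, x ∈ Finsupp.supported R R (Set.Iic i) → ∃ r : R, x i = r * v i i) :
    N ≤ Submodule.span R (v '' {i | v i i ≠ 0}) := by
  have mem_span (i : ι) : ∀ x ∈ N, x ∈ Finsupp.supported R R (Set.Iic i) →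
      x ∈ Submodule.span R (v '' {i | v i i ≠ 0}) := by
    induction i using WellFoundedLT.induction with
    | ind i ih =>
      intro x hxN hx
      obtain ⟨r, hr, hrv⟩ : ∃ r, x i = r * v i i ∧
          r • v i ∈ Submodule.span R (v '' {i | v i i ≠ 0}) := by
        obtain ⟨r, hr⟩ := hgen i x hxN hx
        by_cases hi : v i i = 0
        · exact ⟨0, by rw [hr, hi, mul_zero, mul_zero], by rw [zero_smul]; exact zero_mem _⟩
        · exact ⟨r, hr, Submodule.smul_mem _ r (Submodule.subset_span ⟨i, hi, rfl⟩)⟩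
      have hi_zero : (x - r • v i) i = 0 := by simp [hr]
      have hsupp := Submodule.sub_mem _ hx (Submodule.smul_mem _ r (hv i))
      rw [← sub_add_cancel x (r • v i)]
      refine Submodule.add_mem _ ?_ hrv
      obtain h | ⟨j, hj, hxj⟩ := finsupp_eq_zero_or_mem_supported_Iic (x - r • v i)
      · exact h ▸ zero_mem _
      · refine ih j (lt_of_le_of_ne (hsupp hj) ?_) _
          (N.sub_mem hxN (N.smul_mem r (hvN i))) hxj
        rintro rfl
        exact Finsupp.mem_support_iff.1 hj hi_zero
  intro x hx
  obtain rfl | ⟨i, -, hi⟩ := finsupp_eq_zero_or_mem_supported_Iic x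
  · exact zero_mem _
  · exact mem_span i x hx hi

theorem free_submodule_finsupp [CommRing R] [IsDomain R] [IsPrincipalIdealRing R]
    (N : Submodule R (ι →₀ R)) : Module.Free R N := by
  obtain ⟨_, _⟩ := exists_wellFoundedLT ι
  let leadingIdeal (i : ι) : Ideal R :=
    (N ⊓ Finsupp.supported R R (Set.Iic i)).map (Finsupp.lapply i)
  have hgen (i : ι) : ∃ b ∈ N ⊓ Finsupp.supported R R (Set.Iic i),
      b i = Submodule.IsPrincipal.generator (leadingIdeal i) :=
    Submodule.mem_map.1 (Submodule.IsPrincipal.generator_mem (leadingIdeal i))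
  choose v hv hvi using hgen
  have hspan : Submodule.span R (v '' {i | v i i ≠ 0}) = N := by
    refine le_antisymm (Submodule.span_le.2 ?_) (le_span_of_forall_exists_apply_eq_mul
      (fun i => (hv i).2) (fun i => (hv i).1) fun i x hxN hx => ?_)
    · rintro _ ⟨i, -, rfl⟩
      exact (hv i).1
    · rw [hvi]
      exact (Submodule.IsPrincipal.mem_iff_eq_smul_generator (leadingIdeal i)).1 ⟨x, ⟨hxN, hx⟩, rfl⟩
  have hli := linearIndepOn_of_mem_supported_Iic fun i => (hv i).2
  rw [← hspan, Set.image_eq_range]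
  exact Module.Free.of_basis (Module.Basis.span hli)

theorem free_submodule_of_isPrincipalIdealRing {M : Type*} [CommRing R] [IsDomain R]
    [IsPrincipalIdealRing R] [AddCommGroup M] [Module R M] [Module.Free R M]
    (N : Submodule R M) : Module.Free R N := by
  let e := (Module.Free.chooseBasis R M).repr
  have := free_submodule_finsupp (N.map e.toLinearMap)
  exact Module.Free.of_equiv (e.submoduleMap N).symm

end FreeSubmodules

section Coboundaries

variable {G A : Type*} [Group G] [AddCommGroup A]

/-- The coboundary of an inhomogeneous 1-cochain with trivial coefficients. -/
def coboundary (b : G → A) (x : G × G) : A := b x.2 - b (x.1 * x.2) + b x.1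

/-- The inhomogeneous 2-cocycle identity for the trivial action of `G` on `A`
(`groupCohomology.IsCocycle₂` would ask for an action as an instance). -/
def IsTwoCocycle (c : G × G → A) : Prop :=
  ∀ g h j, c (g * h, j) + c (g, h) = c (h, j) + c (g, h * j)

theorem IsTwoCocycle.apply_one_left {c : G × G → A} (hc : IsTwoCocycle c) (g : G) :
    c (1, g) = c (1, 1) := by
  simpa using (hc 1 1 g).symm

theorem IsTwoCocycle.apply_one_right {c : G × G → A} (hc : IsTwoCocycle c) (g : G) :
    c (g, 1) = c (1, 1) := by
  simpa using hc g 1 1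

variable {k : Type*} [Ring k] [Module k A]

theorem linearCombination_coboundary (b : G → A) (z : G × G →₀ k) :
    Finsupp.linearCombination k (coboundary b) z =
      Finsupp.linearCombination k b (barBoundary k z) := by
  induction z using Finsupp.induction_linear with
  | zero => simp
  | add u v hu hv => rw [map_add, map_add, map_add, hu, hv]
  | single x r =>
    simp only [barBoundary_single, map_add, map_sub, Finsupp.linearCombination_single, coboundary,
      smul_add, smul_sub]
    abel

theorem exists_comp_eq_of_ker_le {M N : Type*} [AddCommGroup M] [AddCommGroup N] [Module k M]
    [Module k N] (hA : Module.Baer k A) (f : M →ₗ[k] N) (l : M →ₗ[k] A)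
    (h : LinearMap.ker f ≤ LinearMap.ker l) : ∃ e : N →ₗ[k] A, e ∘ₗ f = l := by
  obtain ⟨e, he⟩ := hA.extension_property ((LinearMap.ker f).liftQ f le_rfl)
    (LinearMap.ker_eq_bot.1 (Submodule.ker_liftQ_eq_bot _ _ _ le_rfl)) ((LinearMap.ker f).liftQ l h)
  exact ⟨e, LinearMap.ext fun z => LinearMap.congr_fun he (Submodule.Quotient.mk z)⟩

theorem exists_eq_coboundary_of_vanishing_on_cycles (hA : Module.Baer k A) {c : G × G → A}
    (hc : ∀ z : G × G →₀ k, barBoundary k z = 0 → Finsupp.linearCombination k c z = 0) :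
    ∃ b : G → A, c = coboundary b := by
  obtain ⟨e, he⟩ := exists_comp_eq_of_ker_le hA (barBoundary k) (Finsupp.linearCombination k c) hc
  refine ⟨fun g => e (Finsupp.single g 1), funext fun x => ?_⟩
  have hx := LinearMap.congr_fun he (Finsupp.single x 1)
  simp only [LinearMap.comp_apply, barBoundary_single, map_add, map_sub,
    Finsupp.linearCombination_single, one_smul] at hx
  rw [← hx, coboundary]
  abel

end Coboundaries

section UniversalCoefficients

theorem exists_retraction_ker {R M P : Type*} [Ring R] [AddCommGroup M] [AddCommGroup P]
    [Module R M] [Module R P] (f : M →ₗ[R] P) [Module.Projective R (LinearMap.range f)] :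
    ∃ r : M →ₗ[R] LinearMap.ker f, ∀ z : LinearMap.ker f, r z = z := by
  obtain ⟨s, hs⟩ := f.rangeRestrict.exists_rightInverse_of_surjective f.range_rangeRestrict
  refine ⟨LinearMap.codRestrict _ (LinearMap.id - s ∘ₗ f.rangeRestrict) fun x => ?_, fun z => ?_⟩
  · have hfs : f (s (f.rangeRestrict x)) = f x :=
      congrArg Subtype.val (LinearMap.congr_fun hs (f.rangeRestrict x))
    simp [hfs]
  · have hz : f.rangeRestrict z = 0 := Subtype.ext z.2
    ext
    simp [hz]

universe u

variable {k G : Type u} [CommRing k] [Group G]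

theorem d₂₁_trivial_eq_barBoundary :
    (groupHomology.d₂₁ (Rep.trivial k G k)).hom = barBoundary k := by
  refine Finsupp.lhom_ext fun x r => ?_
  erw [groupHomology.d₂₁_single]
  rw [barBoundary_single, add_sub_assoc, add_comm]
  rfl

theorem mem_cycles₂_trivial_iff {z : G × G →₀ k} :
    z ∈ groupHomology.cycles₂ (Rep.trivial k G k) ↔ barBoundary k z = 0 := by
  rw [← d₂₁_trivial_eq_barBoundary]
  rfl

theorem exists_cocycle_linearCombination_eq {A : ModuleCat.{u} k} (F : (G × G →₀ k) →ₗ[k] A)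
    (hF : ∀ z ∈ groupHomology.boundaries₂ (Rep.trivial k G k), F z = 0) :
    ∃ c : groupCohomology.cocycles₂ (Rep.trivial k G A),
      ∀ z, Finsupp.linearCombination k (fun x => (c.1 x : A)) z = F z := by
  have hcocycle : IsTwoCocycle fun x : G × G => F (Finsupp.single x 1) := fun g h j => by
    have hboundary : F (Finsupp.single (h, j) 1 - Finsupp.single (g * h, j) 1 +
        Finsupp.single (g, h * j) 1 - Finsupp.single (g, h) 1) = 0 :=
      hF _ ⟨Finsupp.single (g, h, j) (1 : k), groupHomology.d₃₂_single _ _⟩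
    simp only [map_add, map_sub] at hboundary
    rw [← sub_eq_zero, ← neg_eq_zero, ← hboundary]
    abel
  refine ⟨⟨fun x => F (Finsupp.single x 1), (groupCohomology.mem_cocycles₂_iff _).2 hcocycle⟩,
    fun z => ?_⟩
  refine LinearMap.congr_fun (Finsupp.lhom_ext fun x r => ?_) z
  rw [Finsupp.linearCombination_single, ← Finsupp.smul_single_one, map_smul]

theorem kronecker_surjective [IsDomain k] [IsPrincipalIdealRing k] (A : ModuleCat.{u} k) :
    Function.Surjective
      (kronecker : trivialCohomology₂ G A →ₗ[k] trivialHomology k G 2 →ₗ[k] A) := by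
  intro f
  let H2π := (groupHomology.H2π (Rep.trivial k G k)).hom
  have := free_submodule_of_isPrincipalIdealRing
    (LinearMap.range (groupHomology.d₂₁ (Rep.trivial k G k)).hom)
  obtain ⟨r, hr⟩ := exists_retraction_ker (groupHomology.d₂₁ (Rep.trivial k G k)).hom
  have hvanish (z) (hz : z ∈ groupHomology.boundaries₂ (Rep.trivial k G k)) :
      (f ∘ₗ H2π ∘ₗ r) z = 0 := by
    let zc : groupHomology.cycles₂ (Rep.trivial k G k) :=
      ⟨z, groupHomology.boundaries₂_le_cycles₂ _ hz⟩
    have hzc : H2π zc = 0 := (groupHomology.H2π_eq_zero_iff zc).2 hz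
    exact (congrArg (f ∘ₗ H2π) (hr zc)).trans ((congrArg f hzc).trans (map_zero f))
  obtain ⟨c, hc⟩ := exists_cocycle_linearCombination_eq (f ∘ₗ H2π ∘ₗ r) hvanish
  refine ⟨groupCohomology.H2π _ c, LinearMap.ext fun y => ?_⟩
  obtain ⟨z, rfl⟩ := groupHomology_H2π_surjective _ y
  exact (kronecker_H2π c z).trans ((hc z.1).trans (congrArg (f ∘ₗ H2π) (hr z)))

theorem exists_cycle_linearCombination_eq {A : ModuleCat.{u} k}
    (c : groupCohomology.cocycles₂ (Rep.trivial k G A)) (y : trivialHomology k G 2) :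
    ∃ z : G × G →₀ k, barBoundary k z = 0 ∧
      Finsupp.linearCombination k (fun x => (c.1 x : A)) z =
        kronecker (groupCohomology.H2π _ c) y := by
  obtain ⟨z, rfl⟩ := groupHomology_H2π_surjective _ y
  exact ⟨z.1, mem_cycles₂_trivial_iff.1 z.2, (kronecker_H2π c z).symm⟩

end UniversalCoefficients

section CocycleExtensions

variable {G A : Type*} [Group G] [AddCommGroup A]

/-- The central extension of `G` by `A` with underlying set `A × G` that is defined by a 2-cocycle;
the cocycle need not be normalized, so the identity is `(-c(1, 1), 1)`. -/
@[ext]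
structure CocycleExtension (c : G × G → A) (hc : IsTwoCocycle c) where
  fst : A
  snd : G

namespace CocycleExtension

variable {c : G × G → A} {hc : IsTwoCocycle c}

instance : Mul (CocycleExtension c hc) :=
  ⟨fun x y => ⟨x.fst + y.fst + c (x.snd, y.snd), x.snd * y.snd⟩⟩

instance : One (CocycleExtension c hc) := ⟨⟨-c (1, 1), 1⟩⟩

instance : Inv (CocycleExtension c hc) :=
  ⟨fun x => ⟨-x.fst - c (x.snd⁻¹, x.snd) - c (1, 1), x.snd⁻¹⟩⟩

theorem fst_one : (1 : CocycleExtension c hc).fst = -c (1, 1) := rfl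

theorem snd_one : (1 : CocycleExtension c hc).snd = 1 := rfl

theorem fst_mul (x y : CocycleExtension c hc) :
    (x * y).fst = x.fst + y.fst + c (x.snd, y.snd) := rfl

theorem snd_mul (x y : CocycleExtension c hc) : (x * y).snd = x.snd * y.snd := rfl

instance : Group (CocycleExtension c hc) :=
  Group.ofLeftAxioms
    (fun x y z => by
      ext
      · calc (x * y * z).fst
            = x.fst + y.fst + z.fst + (c (x.snd * y.snd, z.snd) + c (x.snd, y.snd)) := by
              simp only [fst_mul, snd_mul]; abel
          _ = (x * (y * z)).fst := by
              rw [hc]; simp only [fst_mul, snd_mul]; abel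
      · exact mul_assoc _ _ _)
    (fun x => by
      ext
      · rw [fst_mul, fst_one, snd_one, hc.apply_one_left x.snd]; abel
      · exact one_mul x.snd)
    (fun x => by
      ext
      · change -x.fst - c (x.snd⁻¹, x.snd) - c (1, 1) + x.fst + c (x.snd⁻¹, x.snd) = -c (1, 1)
        abel
      · exact inv_mul_cancel x.snd)

variable (c hc) in
/-- The projection of the extension onto `G`. -/
@[simps]
def proj : CocycleExtension c hc →* G where
  toFun := snd
  map_one' := rfl
  map_mul' _ _ := rfl

variable (c hc) in
/-- The inclusion of the coefficient group, with the shift required for the non-normalized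
identity element. -/
@[simps]
def incl (a : A) : CocycleExtension c hc := ⟨a - c (1, 1), 1⟩

theorem fst_incl_mul (a : A) (x : CocycleExtension c hc) :
    (incl c hc a * x).fst = a + x.fst := by
  rw [fst_mul, incl_fst, incl_snd, hc.apply_one_left x.snd]
  abel

theorem snd_incl_mul (a : A) (x : CocycleExtension c hc) :
    (incl c hc a * x).snd = x.snd := one_mul _

theorem incl_add (a b : A) : incl c hc (a + b) = incl c hc a * incl c hc b := by
  ext
  · rw [fst_incl_mul, incl_fst, incl_fst, add_sub_assoc]
  · rw [snd_incl_mul, incl_snd, incl_snd]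

theorem incl_mem_center (a : A) : incl c hc a ∈ Subgroup.center (CocycleExtension c hc) := by
  refine Subgroup.mem_center_iff.2 fun x => ?_
  ext
  · rw [fst_incl_mul, fst_mul, incl_fst, incl_snd, hc.apply_one_right x.snd]
    abel
  · rw [snd_incl_mul]
    exact mul_one _

/-- The homomorphism of extensions that is induced by a homomorphism of coefficient groups. -/
@[simps]
def map {B : Type*} [AddCommGroup B] (q : A →+ B) (hqc : IsTwoCocycle (q ∘ c)) :
    CocycleExtension c hc →* CocycleExtension (q ∘ c) hqc where
  toFun x := ⟨q x.fst, x.snd⟩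
  map_one' := by ext <;> simp [fst_one, snd_one]
  map_mul' x y := by ext <;> simp [fst_mul, snd_mul]

theorem eq_coboundary_of_splitting (s : G →* CocycleExtension c hc) (hs : ∀ g, (s g).snd = g) :
    c = coboundary fun g => -(s g).fst := by
  funext x
  have h := congrArg fst (map_mul s x.1 x.2)
  rw [fst_mul, hs, hs] at h
  rw [coboundary, h]
  abel

end CocycleExtension

theorem IsTwoCocycle.comp {B : Type*} [AddCommGroup B] {c : G × G → A} (hc : IsTwoCocycle c)
    (q : A →+ B) : IsTwoCocycle (q ∘ c) := fun g h j => by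
  simp only [Function.comp_apply, ← map_add, hc g h j]

theorem isTwoCocycle_coboundary (b : G → A) : IsTwoCocycle (coboundary b) := fun g h j => by
  simp only [coboundary, mul_assoc]
  abel

theorem IsTwoCocycle.sub {c d : G × G → A} (hc : IsTwoCocycle c) (hd : IsTwoCocycle d) :
    IsTwoCocycle (c - d) := fun g h j => by
  simp only [Pi.sub_apply, sub_add_sub_comm, hc g h j, hd g h j]

theorem isTwoCocycle_of_map_mul {W : Type*} [Group W] {q : W →* G} (hq : Function.Surjective q)
    {R : W → A} {c : G × G → A} (hR : ∀ p p', R (p * p') = R p + R p' + c (q p, q p')) :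
    IsTwoCocycle c := by
  refine hq.forall.2 fun x => hq.forall.2 fun y => hq.forall.2 fun z => ?_
  have hassoc := congrArg R (mul_assoc x y z)
  simp only [hR, map_mul] at hassoc
  rw [← add_right_inj (R x + R y + R z)]
  calc _ = _ := by abel
    _ = _ := hassoc
    _ = _ := by abel

end CocycleExtensions

section FiniteGeneration

variable {G : Type*} [Group G]

theorem exists_eq_coboundary_of_lift_eq_one {F A : Type*} [Group F] [AddCommGroup A]
    {c : G × G → A} {hc : IsTwoCocycle c} {π : F →* G} (hπ : Function.Surjective π) {R : Set F}
    (hR : Subgroup.normalClosure R = π.ker) (l : F →* CocycleExtension c hc)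
    (hl : ∀ w, (l w).snd = π w) (hlR : ∀ r ∈ R, l r = 1) : ∃ b : G → A, c = coboundary b := by
  have hker : π.ker ≤ l.ker := hR ▸ Subgroup.normalClosure_le_normal hlR
  let s : G →* CocycleExtension c hc := π.liftOfSurjective hπ ⟨l, hker⟩
  have hs (w : F) : s (π w) = l w := π.liftOfRightInverse_comp_apply _ _ ⟨l, hker⟩ w
  refine ⟨_, CocycleExtension.eq_coboundary_of_splitting s fun g => ?_⟩
  obtain ⟨w, rfl⟩ := hπ g
  rw [hs, hl]

theorem finite_of_surjective_evaluation [hG : Group.IsFinitelyPresented G] {k A : Type*} [Ring k]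
    [AddCommGroup A] [Module k A] {c : G × G → A} (hc : IsTwoCocycle c)
    (hsurj : ∀ a : A, ∃ z : G × G →₀ k,
      barBoundary k z = 0 ∧ Finsupp.linearCombination k c z = a) : Module.Finite k A := by
  obtain ⟨n, π, hπ, R, hRfin, hR⟩ := hG.out
  let l : FreeGroup (Fin n) →* CocycleExtension c hc :=
    FreeGroup.lift fun i => ⟨0, π (FreeGroup.of i)⟩
  have hl (w) : (l w).snd = π w :=
    DFunLike.congr_fun (show (CocycleExtension.proj c hc).comp l = π by ext; simp [l]) w
  let B : Submodule k A := Submodule.span k ((fun r => (l r).fst + c (1, 1)) '' R)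
  let q : A →+ A ⧸ B := B.mkQ.toAddMonoidHom
  have hlR : ∀ r ∈ R, CocycleExtension.map (hc := hc) q (hc.comp q) (l r) = 1 := fun r hr => by
    have hrB : q ((l r).fst + c (1, 1)) = 0 :=
      (Submodule.Quotient.mk_eq_zero B).2 (Submodule.subset_span ⟨r, hr, rfl⟩)
    have hπr : r ∈ π.ker := hR ▸ Subgroup.subset_normalClosure hr
    ext
    · exact eq_neg_of_add_eq_zero_left ((map_add q _ _).symm.trans hrB)
    · exact (hl r).trans hπr
  obtain ⟨b, hb⟩ := exists_eq_coboundary_of_lift_eq_one hπ hR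
    ((CocycleExtension.map q (hc.comp q)).comp l) hl hlR
  have htop : B = ⊤ := eq_top_iff.2 fun a _ => by
    obtain ⟨z, hz, rfl⟩ := hsurj a
    rw [← Submodule.Quotient.mk_eq_zero, ← Submodule.mkQ_apply, Finsupp.apply_linearCombination]
    refine (congrArg (fun d => Finsupp.linearCombination k d z) hb).trans ?_
    rw [linearCombination_coboundary, hz, map_zero]
  exact ⟨htop ▸ Submodule.fg_span (hRfin.image _)⟩

universe u in
theorem finite_trivialHomology_two (k G : Type u) [CommRing k] [IsDomain k]
    [IsPrincipalIdealRing k] [Group G] [Group.IsFinitelyPresented G] :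
    Module.Finite k (trivialHomology k G 2) := by
  obtain ⟨φ, hφ⟩ := kronecker_surjective (G := G) (trivialHomology k G 2) LinearMap.id
  obtain ⟨c, rfl⟩ := groupCohomology_H2π_surjective _ φ
  refine finite_of_surjective_evaluation (G := G)
    ((groupCohomology.mem_cocycles₂_iff c.1).1 c.2) fun a => ?_
  obtain ⟨z, hz, hza⟩ := exists_cycle_linearCombination_eq c a
  exact ⟨z, hz, hza.trans (LinearMap.congr_fun hφ a)⟩

end FiniteGeneration

section AbelianQuasimorphisms

open Filter Topology

variable {A : Type*} [AddCommGroup A] {f : A → ℝ} {D : ℝ}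

/-- The means `f(2ⁿ a) / 2ⁿ`, whose limit homogenizes a quasimorphism `f`. -/
noncomputable def dyadicMean (f : A → ℝ) (a : A) (n : ℕ) : ℝ := f (2 ^ n • a) / 2 ^ n

theorem dist_dyadicMean_succ_le (hf : ∀ a b, |f (a + b) - f a - f b| ≤ D) (a : A) (n : ℕ) :
    dist (dyadicMean f a n) (dyadicMean f a (n + 1)) ≤ D / 2 / 2 ^ n := by
  have h := hf (2 ^ n • a) (2 ^ n • a)
  rw [← two_nsmul, smul_smul, ← pow_succ'] at h
  have hdiff : dyadicMean f a n - dyadicMean f a (n + 1) =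
      -(f (2 ^ (n + 1) • a) - f (2 ^ n • a) - f (2 ^ n • a)) / 2 / 2 ^ n := by
    simp only [dyadicMean]
    field
  rw [Real.dist_eq, hdiff, abs_div, abs_div, abs_neg, abs_of_pos (two_pos (α := ℝ)),
    abs_of_pos (pow_pos (two_pos (α := ℝ)) n)]
  gcongr

theorem tendsto_dyadicMean_add_sub (hf : ∀ a b, |f (a + b) - f a - f b| ≤ D) (a b : A) :
    Tendsto (fun n => dyadicMean f (a + b) n - dyadicMean f a n - dyadicMean f b n)
      atTop (𝓝 0) := by
  have hlim : Tendsto (fun n : ℕ => D / 2 ^ n) atTop (𝓝 0) :=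
    tendsto_const_nhds.div_atTop (tendsto_pow_atTop_atTop_of_one_lt one_lt_two)
  refine squeeze_zero_norm (fun n => ?_) hlim
  have hdiff : dyadicMean f (a + b) n - dyadicMean f a n - dyadicMean f b n =
      (f (2 ^ n • a + 2 ^ n • b) - f (2 ^ n • a) - f (2 ^ n • b)) / 2 ^ n := by
    simp only [dyadicMean, smul_add]
    ring
  rw [hdiff, Real.norm_eq_abs, abs_div, abs_of_pos (pow_pos (two_pos (α := ℝ)) n)]
  gcongr
  exact hf _ _

theorem exists_addMonoidHom_near (hf : ∀ a b, |f (a + b) - f a - f b| ≤ D) :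
    ∃ l : A →+ ℝ, ∀ a, |f a - l a| ≤ D := by
  choose l hl using fun a =>
    cauchySeq_tendsto_of_complete (cauchySeq_of_le_geometric_two (dist_dyadicMean_succ_le hf a))
  have hadd (a b : A) : l (a + b) = l a + l b := by
    have h := tendsto_nhds_unique (tendsto_dyadicMean_add_sub hf a b)
      (((hl (a + b)).sub (hl a)).sub (hl b))
    linarith
  refine ⟨AddMonoidHom.mk' l hadd, fun a => ?_⟩
  have h := dist_le_of_le_geometric_two_of_tendsto₀ (dist_dyadicMean_succ_le hf a) (hl a)
  simpa [dyadicMean, Real.dist_eq] using h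

end AbelianQuasimorphisms

section QuasimorphismSpaces

variable {G G' : Type*} [Group G] [Group G']

theorem addMonoidHom_eq_zero_of_bounded {A : Type*} [AddMonoid A] (l : A →+ ℝ) {C : ℝ}
    (hl : ∀ a, |l a| ≤ C) : l = 0 := by
  refine AddMonoidHom.ext fun a => by_contra fun ha => ?_
  obtain ⟨n, hn⟩ := exists_nat_gt (C / |l a|)
  rw [div_lt_iff₀ (abs_pos.2 ha)] at hn
  have h := hl (n • a)
  rw [map_nsmul, nsmul_eq_mul, abs_mul, Nat.abs_cast] at h
  exact h.not_gt hn

theorem addMonoidHom_eq_zero_of_forall_quasimorphism_bounded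
    (hG : ∀ f ∈ quasimorphisms G, ∃ C, ∀ g, |f g| ≤ C) (χ : Additive G →+ ℝ) : χ = 0 := by
  obtain ⟨C, hC⟩ := hG (fun g => χ (Additive.ofMul g)) ⟨0, fun g h => by simp⟩
  exact addMonoidHom_eq_zero_of_bounded χ hC

theorem mem_quasimorphisms_of_near {f f' : G → ℝ} (hf : f ∈ quasimorphisms G) {C : ℝ}
    (h : ∀ g, |f g - f' g| ≤ C) : f' ∈ quasimorphisms G := by
  have hsub : f - f' ∈ quasimorphisms G := by
    refine ⟨C + C + C, fun a b => (abs_sub _ _).trans ?_⟩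
    exact add_le_add ((abs_sub _ _).trans (add_le_add (h _) (h a))) (h b)
  simpa using sub_mem hf hsub

theorem mem_trivialQuasimorphisms_iff_of_hom_eq_zero (hG : ∀ χ : Additive G →+ ℝ, χ = 0)
    {f : quasimorphisms G} : f ∈ trivialQuasimorphisms G ↔ ∃ C, ∀ g, |f.1 g| ≤ C := by
  refine ⟨fun ⟨χ, C, hC⟩ => ⟨C, fun g => ?_⟩, fun ⟨C, hC⟩ => ⟨0, C, by simpa using hC⟩⟩
  simpa [hG χ] using hC g

theorem finrank_quasimorphismSpace_eq_one (hG : ∀ χ : Additive G →+ ℝ, χ = 0)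
    (f₀ : quasimorphisms G) (hf₀ : ¬ ∃ C, ∀ g, |f₀.1 g| ≤ C)
    (h : ∀ f ∈ quasimorphisms G, ∃ t C : ℝ, ∀ g, |f g - t * f₀.1 g| ≤ C) :
    Module.finrank ℝ (QuasimorphismSpace G) = 1 := by
  refine finrank_eq_one_iff'.2 ⟨Submodule.Quotient.mk f₀, fun h₀ => ?_, fun w => ?_⟩
  · rw [Submodule.Quotient.mk_eq_zero, mem_trivialQuasimorphisms_iff_of_hom_eq_zero hG] at h₀
    exact hf₀ h₀
  · obtain ⟨f, rfl⟩ := Submodule.Quotient.mk_surjective _ w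
    obtain ⟨t, C, hC⟩ := h f f.2
    refine ⟨t, ?_⟩
    rw [← Submodule.Quotient.mk_smul, eq_comm, Submodule.Quotient.eq]
    exact (mem_trivialQuasimorphisms_iff_of_hom_eq_zero hG).2 ⟨C, hC⟩

theorem quasimorphismMap_injective (hG : ∀ χ : Additive G →+ ℝ, χ = 0) {ψ : G →* G'}
    (hψ : Function.Surjective ψ) : Function.Injective (quasimorphismMap ψ) := by
  rw [injective_iff_map_eq_zero]
  intro x hx
  obtain ⟨f, rfl⟩ := Submodule.Quotient.mk_surjective _ x
  obtain ⟨C, hC⟩ := (mem_trivialQuasimorphisms_iff_of_hom_eq_zero hG).1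
    ((Submodule.Quotient.mk_eq_zero _).1 hx)
  refine (Submodule.Quotient.mk_eq_zero _).2 ⟨0, C, hψ.forall.2 fun g => ?_⟩
  simpa using! hC g

theorem quasimorphismMap_bijective (hG : ∀ χ : Additive G →+ ℝ, χ = 0)
    (hQ : Module.finrank ℝ (QuasimorphismSpace G) = 1)
    (hQ' : Module.finrank ℝ (QuasimorphismSpace G') = 1) {ψ : G →* G'}
    (hψ : Function.Surjective ψ) : Function.Bijective (quasimorphismMap ψ) := by
  have := Module.finite_of_finrank_eq_succ hQ
  have := Module.finite_of_finrank_eq_succ hQ'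
  have hinj := quasimorphismMap_injective hG hψ
  have hrank := hQ'.trans hQ.symm
  exact ⟨hinj, (LinearMap.injective_iff_surjective_of_finrank_eq_finrank hrank).1 hinj⟩

end QuasimorphismSpaces

section Transgression

variable {Γ A : Type*} [Group Γ] [AddCommGroup A]

/-- Injectivity of the transgression `Hom(A, ℝ) → H²(Γ; ℝ)`, `l ↦ [l ∘ c]`, of the central
extension with cocycle `c`. -/
def InjectiveTransgression (c : Γ × Γ → A) : Prop :=
  ∀ (l : A →+ ℝ) (b : Γ → ℝ), l ∘ c = coboundary b → l = 0

/-- Surjectivity of the transgression `Hom(A, ℝ) → H²(Γ; ℝ)`, `l ↦ [l ∘ c]`, of the central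
extension with cocycle `c`. -/
def SurjectiveTransgression (c : Γ × Γ → A) : Prop :=
  ∀ α : Γ × Γ → ℝ, IsTwoCocycle α → ∃ (l : A →+ ℝ) (b : Γ → ℝ), α = l ∘ c + coboundary b

theorem injectiveTransgression_of_evaluation [Module ℤ A] {c : Γ × Γ → A} {m : ℤ} (hm : m ≠ 0)
    (hc : ∀ a, ∃ z : Γ × Γ →₀ ℤ, barBoundary ℤ z = 0 ∧ Finsupp.linearCombination ℤ c z = m • a) :
    InjectiveTransgression c := fun l b hlb => by
  let L : A →ₗ[ℤ] ℝ := { l with map_smul' := fun n a => by simpa using map_intCast_smul l ℤ ℤ n a }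
  refine AddMonoidHom.ext fun a => ?_
  obtain ⟨z, hz, hza⟩ := hc a
  have hma : m • L a = 0 := by
    calc m • L a = L (Finsupp.linearCombination ℤ c z) := by rw [hza, map_zsmul]
      _ = Finsupp.linearCombination ℤ (coboundary b) z := by
        rw [Finsupp.apply_linearCombination, ← hlb]; rfl
      _ = 0 := by rw [linearCombination_coboundary, hz, map_zero]
  exact (smul_eq_zero.1 hma).resolve_left hm

theorem surjectiveTransgression_of_kronecker {Γ : Type} [Group Γ] {m : ℕ} (hm : m ≠ 0)
    (c : groupCohomology.cocycles₂ (Rep.trivial ℤ Γ (trivialHomology ℤ Γ 2)))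
    (hc : ∀ y, kronecker (groupCohomology.H2π _ c) y = m • y) :
    SurjectiveTransgression fun x => (c.1 x : trivialHomology ℤ Γ 2) := fun α hα => by
  let a : groupCohomology.cocycles₂ (Rep.trivial ℤ Γ (ModuleCat.of ℤ ℝ)) :=
    ⟨α, (groupCohomology.mem_cocycles₂_iff _).2 hα⟩
  let l : trivialHomology ℤ Γ 2 →ₗ[ℤ] ℝ := (m : ℝ)⁻¹ • kronecker (groupCohomology.H2π _ a)
  have hml (y) : l (m • y) = kronecker (groupCohomology.H2π _ a) y := by
    rw [map_nsmul, nsmul_eq_mul]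
    exact mul_inv_cancel_left₀ (Nat.cast_ne_zero.2 hm) _
  have hcycles (z : Γ × Γ →₀ ℤ) (hz : barBoundary ℤ z = 0) :
      Finsupp.linearCombination ℤ (α - l ∘ fun x => (c.1 x : trivialHomology ℤ Γ 2)) z = 0 := by
    let z' : groupHomology.cycles₂ (Rep.trivial ℤ Γ ℤ) := ⟨z, mem_cycles₂_trivial_iff.2 hz⟩
    refine (LinearMap.congr_fun (map_sub (Finsupp.bilinearCombination ℤ ℤ) _ _) z).trans
      (sub_eq_zero.2 ?_)
    calc Finsupp.linearCombination ℤ α z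
        = kronecker (groupCohomology.H2π _ a) (groupHomology.H2π _ z') := (kronecker_H2π a z').symm
      _ = l (kronecker (groupCohomology.H2π _ c) (groupHomology.H2π _ z')) := by rw [hc, hml]
      _ = l (Finsupp.linearCombination ℤ (fun x => (c.1 x : trivialHomology ℤ Γ 2)) z) :=
        congrArg l (kronecker_H2π c z')
      _ = _ := Finsupp.apply_linearCombination ℤ l _ z
  obtain ⟨b, hb⟩ :=
    exists_eq_coboundary_of_vanishing_on_cycles (Module.Baer.of_divisible ℝ) hcycles
  exact ⟨l.toAddMonoidHom, b, sub_eq_iff_eq_add'.1 hb⟩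

end Transgression

section CentralCoordinates

variable {Γ E A : Type*} [Group Γ] [Group E] [AddCommGroup A]

/-- A section and the associated fibre coordinate of a central extension with cocycle `c`; they
identify the extension with `CocycleExtension c`. -/
structure CentralCoordinates (S : GroupExtension (Multiplicative A) E Γ) (c : Γ × Γ → A) where
  sec : Γ → E
  coord : E → A
  rightHom_sec : ∀ g, S.rightHom (sec g) = g
  inl_mul_sec : ∀ e, S.inl (Multiplicative.ofAdd (coord e)) * sec (S.rightHom e) = e
  coord_inl_mul : ∀ a e, coord (S.inl (Multiplicative.ofAdd a) * e) = a + coord e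
  coord_mul : ∀ e e', coord (e * e') = coord e + coord e' + c (S.rightHom e, S.rightHom e')

theorem exists_inl_mul_section_eq {S : GroupExtension (Multiplicative A) E Γ} (σ : S.Section)
    (e : E) : ∃! a : A, S.inl (Multiplicative.ofAdd a) * σ (S.rightHom e) = e := by
  have hker : e * (σ (S.rightHom e))⁻¹ ∈ S.inl.range := by
    rw [S.range_inl_eq_ker_rightHom, MonoidHom.mem_ker, map_mul, map_inv,
      σ.rightHom_section, mul_inv_cancel]
  obtain ⟨a, ha⟩ := hker
  refine ⟨a.toAdd, mul_inv_eq_iff_eq_mul.1 ha.symm |>.symm, fun a' ha' => ?_⟩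
  exact S.inl_injective ((eq_mul_inv_of_mul_eq ha').trans ha.symm)

theorem exists_centralCoordinates {S : GroupExtension (Multiplicative A) E Γ}
    (hS : S.inl.range ≤ Subgroup.center E) {σ : S.Section} {c : Γ × Γ → A}
    (hc : ∀ g h, σ g * σ h = S.inl (Multiplicative.ofAdd (c (g, h))) * σ (g * h)) :
    Nonempty (CentralCoordinates S c) := by
  choose F hF hFunique using exists_inl_mul_section_eq σ
  have hcomm (a : Multiplicative A) (x : E) : Commute x (S.inl a) :=
    Subgroup.mem_center_iff.1 (hS ⟨a, rfl⟩) x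
  refine ⟨⟨σ, F, σ.rightHom_section, hF, fun a e => ?_, fun e e' => ?_⟩⟩
  · refine (hFunique _ _ ?_).symm
    simp only [ofAdd_add, map_mul, S.rightHom_inl, one_mul, mul_assoc, hF]
  · refine (hFunique _ _ ?_).symm
    calc S.inl (.ofAdd (F e + F e' + c (S.rightHom e, S.rightHom e'))) * σ (S.rightHom (e * e'))
        = S.inl (.ofAdd (F e)) * S.inl (.ofAdd (F e')) *
            (σ (S.rightHom e) * σ (S.rightHom e')) := by
          simp only [hc, ofAdd_add, map_mul, mul_assoc]
      _ = S.inl (.ofAdd (F e)) * σ (S.rightHom e) *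
            (S.inl (.ofAdd (F e')) * σ (S.rightHom e')) := by
          exact (hcomm _ _).symm.mul_mul_mul_comm _ _
      _ = e * e' := by rw [hF, hF]

theorem IsCentralExtensionOfClass.exists_centralCoordinates {Γ E : Type} [Group Γ] [Group E]
    {A : ModuleCat.{0} ℤ} {S : GroupExtension (Multiplicative A) E Γ} {φ : trivialCohomology₂ Γ A}
    (hS : IsCentralExtensionOfClass S φ) :
    ∃ c : groupCohomology.cocycles₂ (Rep.trivial ℤ Γ A),
      groupCohomology.H2π _ c = φ ∧ Nonempty (CentralCoordinates S fun x => (c.1 x : A)) := by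
  obtain ⟨hcenter, σ, c, hσ, hc⟩ := hS
  exact ⟨c, hc, _root_.exists_centralCoordinates hcenter hσ⟩

namespace CentralCoordinates

variable {S : GroupExtension (Multiplicative A) E Γ} {c : Γ × Γ → A}

theorem isTwoCocycle (K : CentralCoordinates S c) : IsTwoCocycle c :=
  isTwoCocycle_of_map_mul S.rightHom_surjective K.coord_mul

variable (K : CentralCoordinates S c)

theorem coord_sec (g : Γ) : K.coord (K.sec g) = 0 := by
  have h := congrArg K.coord (K.inl_mul_sec (K.sec g))
  rwa [K.coord_inl_mul, K.rightHom_sec, add_eq_right] at h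

theorem sec_mul_sec (g h : Γ) :
    K.sec g * K.sec h = S.inl (Multiplicative.ofAdd (c (g, h))) * K.sec (g * h) := by
  conv_lhs => rw [← K.inl_mul_sec (K.sec g * K.sec h)]
  rw [K.coord_mul, map_mul, K.rightHom_sec, K.rightHom_sec, K.coord_sec, K.coord_sec, zero_add,
    zero_add]

theorem coord_inl (a : A) : K.coord (S.inl (Multiplicative.ofAdd a)) = a + K.coord 1 := by
  rw [← K.coord_inl_mul, mul_one]

theorem hom_eq_zero (K : CentralCoordinates S c) (hΓ : ∀ χ : Additive Γ →+ ℝ, χ = 0)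
    (hc : InjectiveTransgression c) (χ : Additive E →+ ℝ) : χ = 0 := by
  let l : A →+ ℝ :=
    χ.comp (MonoidHom.toAdditive S.inl : Additive (Multiplicative A) →+ Additive E)
  let u (g : Γ) : ℝ := χ (Additive.ofMul (K.sec g))
  have hlu : l ∘ c = coboundary u := funext fun x => by
    have h := congrArg (χ ∘ Additive.ofMul) (K.sec_mul_sec x.1 x.2)
    simp only [Function.comp_apply, ofMul_mul, map_add] at h
    change u x.1 + u x.2 = l (c x) + u (x.1 * x.2) at h
    simp only [Function.comp_apply, coboundary]
    linarith
  have hl : l = 0 := hc l u hlu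
  have hu : AddMonoidHom.mk' (fun g : Additive Γ => u g.toMul) (fun g h => by
      have h := congrFun hlu (g.toMul, h.toMul)
      simp only [hl, Function.comp_apply, AddMonoidHom.zero_apply, coboundary] at h
      rw [toMul_add]
      linarith) = 0 := hΓ _
  refine AddMonoidHom.ext fun e => ?_
  have he : χ e = l (K.coord e.toMul) + u (S.rightHom e.toMul) :=
    (congrArg (χ ∘ Additive.ofMul) (K.inl_mul_sec e.toMul)).symm.trans (map_add χ _ _)
  rw [he, hl, AddMonoidHom.zero_apply, AddMonoidHom.zero_apply, zero_add]
  exact DFunLike.congr_fun hu (Additive.ofMul _)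

end CentralCoordinates

end CentralCoordinates

theorem mem_quasimorphisms_iff_bounded_coboundary {G : Type*} [Group G] {u : G → ℝ} :
    u ∈ quasimorphisms G ↔ ∃ C, ∀ x, |coboundary u x| ≤ C := by
  refine exists_congr fun C => (forall₂_congr fun g h => ?_).trans Prod.forall.symm
  rw [coboundary, ← abs_neg]
  ring_nf

section BoundedCohomology

variable {Γ : Type} [Group Γ]

/-- The bounded cocycle `e` represents a generator of the one-dimensional space `H²_b(Γ; ℝ)`. -/
structure GeneratesBoundedCohomology (e : Γ × Γ → ℝ) : Prop where
  mem : e ∈ boundedCocycles₂ Γ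
  span_eq_top : Submodule.span ℝ {(Submodule.Quotient.mk ⟨e, mem⟩ : BoundedCohomology₂ Γ)} = ⊤
  finrank_eq_one : Module.finrank ℝ (BoundedCohomology₂ Γ) = 1

theorem mem_boundedCocycles₂_iff {β : Γ × Γ → ℝ} :
    β ∈ boundedCocycles₂ Γ ↔ IsTwoCocycle β ∧ ∃ C, ∀ x, |β x| ≤ C :=
  and_congr_left' (groupCohomology.mem_cocycles₂_iff (A := Rep.trivial ℝ Γ ℝ) β)

namespace GeneratesBoundedCohomology

variable {e : Γ × Γ → ℝ}

theorem exists_eq_smul_add_coboundary (he : GeneratesBoundedCohomology e) {β : Γ × Γ → ℝ}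
    (hβ : β ∈ boundedCocycles₂ Γ) : ∃ (t : ℝ) (v : Γ → ℝ), β = t • e + coboundary v := by
  obtain ⟨t, ht⟩ := Submodule.mem_span_singleton.1 (he.span_eq_top ▸ Submodule.mem_top :
    (Submodule.Quotient.mk ⟨β, hβ⟩ : BoundedCohomology₂ Γ) ∈ _)
  rw [← Submodule.Quotient.mk_smul, eq_comm, Submodule.Quotient.eq] at ht
  obtain ⟨v, -, hv⟩ := ht
  exact ⟨t, v, sub_eq_iff_eq_add'.1 (funext fun x => hv x.1 x.2)⟩

theorem ne_coboundary (he : GeneratesBoundedCohomology e)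
    (hΓ : ∀ f ∈ quasimorphisms Γ, ∃ C, ∀ g, |f g| ≤ C) (b : Γ → ℝ) : e ≠ coboundary b := by
  rintro rfl
  have hb : b ∈ quasimorphisms Γ :=
    mem_quasimorphisms_iff_bounded_coboundary.2 (mem_boundedCocycles₂_iff.1 he.mem).2
  have hspan := he.span_eq_top
  have hclass : (⟨coboundary b, he.mem⟩ : boundedCocycles₂ Γ) ∈ boundedCoboundaries₂ Γ :=
    ⟨b, hΓ b hb, fun _ _ => rfl⟩
  rw [(Submodule.Quotient.mk_eq_zero _).2 hclass,
    Submodule.span_zero_singleton] at hspan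
  have hrank := he.finrank_eq_one
  rw [← finrank_top, ← hspan, finrank_bot] at hrank
  exact zero_ne_one hrank

theorem exists_cycle_linearCombination_ne_zero (he : GeneratesBoundedCohomology e)
    (hΓ : ∀ f ∈ quasimorphisms Γ, ∃ C, ∀ g, |f g| ≤ C) :
    ∃ z : Γ × Γ →₀ ℤ, barBoundary ℤ z = 0 ∧ Finsupp.linearCombination ℤ e z ≠ 0 := by
  by_contra! hvanish
  obtain ⟨b, hb⟩ :=
    exists_eq_coboundary_of_vanishing_on_cycles (Module.Baer.of_divisible ℝ) hvanish
  exact he.ne_coboundary hΓ b hb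

end GeneratesBoundedCohomology

end BoundedCohomology

namespace CentralCoordinates

section CoordQuasimorphism

variable {Γ E A : Type*} [Group Γ] [Group E] [AddCommGroup A]
  {S : GroupExtension (Multiplicative A) E Γ} {c : Γ × Γ → A} (K : CentralCoordinates S c)
  {χ : A →+ ℝ} {b : Γ → ℝ}

/-- The function `χ ∘ coord + b ∘ π` on a central extension with projection `π`. Up to bounded
functions, every quasimorphism on the extension is of this form. -/
def coordQuasimorphism (χ : A →+ ℝ) (b : Γ → ℝ) (x : E) : ℝ :=
  χ (K.coord x) + b (S.rightHom x)

theorem coordQuasimorphism_mul (x y : E) :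
    K.coordQuasimorphism χ b (x * y) - K.coordQuasimorphism χ b x - K.coordQuasimorphism χ b y =
      (χ ∘ c - coboundary b) (S.rightHom x, S.rightHom y) := by
  simp only [coordQuasimorphism, K.coord_mul, map_add, map_mul, Pi.sub_apply, Function.comp_apply,
    coboundary]
  ring

theorem coordQuasimorphism_mem_quasimorphisms_iff :
    K.coordQuasimorphism χ b ∈ quasimorphisms E ↔ ∃ C, ∀ x, |(χ ∘ c - coboundary b) x| ≤ C := by
  refine exists_congr fun C => ⟨fun h x => ?_, fun h x y => ?_⟩
  · simpa only [coordQuasimorphism_mul, K.rightHom_sec] using h (K.sec x.1) (K.sec x.2)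
  · rw [coordQuasimorphism_mul]
    exact h _

theorem exists_near_coordQuasimorphism {f : E → ℝ} (hf : f ∈ quasimorphisms E) :
    ∃ (l : A →+ ℝ) (u : Γ → ℝ) (C : ℝ), ∀ x, |f x - K.coordQuasimorphism l u x| ≤ C := by
  obtain ⟨D, hD⟩ := hf
  obtain ⟨l, hl⟩ := exists_addMonoidHom_near (f := fun a => f (S.inl (Multiplicative.ofAdd a)))
    fun a a' => by simpa only [ofAdd_add, map_mul] using hD _ _
  refine ⟨l, fun g => f (K.sec g), D + D, fun x => ?_⟩
  have hx := hD (S.inl (Multiplicative.ofAdd (K.coord x))) (K.sec (S.rightHom x))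
  rw [K.inl_mul_sec] at hx
  calc |f x - K.coordQuasimorphism l (fun g => f (K.sec g)) x|
      = |(f x - f (S.inl (Multiplicative.ofAdd (K.coord x))) - f (K.sec (S.rightHom x))) +
          (f (S.inl (Multiplicative.ofAdd (K.coord x))) - l (K.coord x))| := by
        rw [coordQuasimorphism]
        ring_nf
    _ ≤ D + D := (abs_add_le _ _).trans (add_le_add hx (hl _))

theorem coordQuasimorphism_inl (a : A) :
    K.coordQuasimorphism χ b (S.inl (Multiplicative.ofAdd a)) =
      χ a + K.coordQuasimorphism χ b 1 := by
  simp only [coordQuasimorphism, K.coord_inl, S.rightHom_inl, map_add, map_one, add_assoc]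

theorem coordQuasimorphism_unbounded (hχ : χ ≠ 0) (b : Γ → ℝ) :
    ¬ ∃ C, ∀ x, |K.coordQuasimorphism χ b x| ≤ C := by
  rintro ⟨C, hC⟩
  refine hχ (addMonoidHom_eq_zero_of_bounded χ (C := C + C) fun a => ?_)
  rw [eq_sub_of_add_eq (K.coordQuasimorphism_inl (χ := χ) (b := b) a).symm]
  exact (abs_sub _ _).trans (add_le_add (hC _) (hC _))

end CoordQuasimorphism

section Generator

variable {Γ : Type} {E A : Type*} [Group Γ] [Group E] [AddCommGroup A]
  {S : GroupExtension (Multiplicative A) E Γ} {c : Γ × Γ → A} (K : CentralCoordinates S c)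
  {χ : A →+ ℝ} {b : Γ → ℝ} {e : Γ × Γ → ℝ}

theorem exists_near_smul_coordQuasimorphism (hΓ : ∀ f ∈ quasimorphisms Γ, ∃ C, ∀ g, |f g| ≤ C)
    (he : GeneratesBoundedCohomology e) (hc : InjectiveTransgression c)
    (hb : χ ∘ c = e + coboundary b) {f : E → ℝ} (hf : f ∈ quasimorphisms E) :
    ∃ t C : ℝ, ∀ x, |f x - t * K.coordQuasimorphism χ b x| ≤ C := by
  obtain ⟨l, u, C, hC⟩ := K.exists_near_coordQuasimorphism hf
  have hβ : l ∘ c - coboundary u ∈ boundedCocycles₂ Γ :=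
    mem_boundedCocycles₂_iff.2 ⟨(K.isTwoCocycle.comp l).sub (isTwoCocycle_coboundary u),
      K.coordQuasimorphism_mem_quasimorphisms_iff.1 (mem_quasimorphisms_of_near hf hC)⟩
  obtain ⟨t, v, htv⟩ := he.exists_eq_smul_add_coboundary hβ
  have hl : l = (AddMonoidHom.mulLeft t).comp χ := by
    refine sub_eq_zero.1 (hc _ (u + v - t • b) (funext fun x => ?_))
    have hx := congrFun htv x
    have hbx := congrFun hb x
    simp only [coboundary, Pi.add_apply, Pi.sub_apply, Pi.smul_apply, Function.comp_apply,
      smul_eq_mul, AddMonoidHom.sub_apply, AddMonoidHom.comp_apply,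
      AddMonoidHom.coe_mulLeft] at hx hbx ⊢
    rw [hbx]
    linear_combination hx
  have hut : coboundary (u - t • b) = t • e - (l ∘ c - coboundary u) := funext fun x => by
    have hbx := congrFun hb x
    simp only [coboundary, Pi.add_apply, Pi.sub_apply, Pi.smul_apply, Function.comp_apply,
      smul_eq_mul, hl, AddMonoidHom.comp_apply, AddMonoidHom.coe_mulLeft] at hbx ⊢
    rw [hbx]
    ring
  obtain ⟨C', hC'⟩ := hΓ (u - t • b) (mem_quasimorphisms_iff_bounded_coboundary.2
    (hut ▸ (sub_mem (Submodule.smul_mem _ t he.mem) hβ).2))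
  refine ⟨t, C + C', fun x => ?_⟩
  calc |f x - t * K.coordQuasimorphism χ b x|
      = |(f x - K.coordQuasimorphism l u x) + (u - t • b) (S.rightHom x)| := by
        simp only [coordQuasimorphism, hl, Pi.sub_apply, Pi.smul_apply, smul_eq_mul,
          AddMonoidHom.comp_apply, AddMonoidHom.coe_mulLeft]
        ring_nf
    _ ≤ C + C' := (abs_add_le _ _).trans (add_le_add (hC x) (hC' _))

theorem finrank_quasimorphismSpace_eq_one (K : CentralCoordinates S c)
    (hΓ : ∀ f ∈ quasimorphisms Γ, ∃ C, ∀ g, |f g| ≤ C) (he : GeneratesBoundedCohomology e)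
    (hc : InjectiveTransgression c) (hb : χ ∘ c = e + coboundary b) :
    Module.finrank ℝ (QuasimorphismSpace E) = 1 := by
  have hχ : χ ≠ 0 := by
    rintro rfl
    refine he.ne_coboundary hΓ (-b) ((eq_neg_of_add_eq_zero_left hb.symm).trans ?_)
    funext x
    simp only [coboundary, Pi.neg_apply]
    ring
  have hf₀ : K.coordQuasimorphism χ b ∈ quasimorphisms E := by
    rw [K.coordQuasimorphism_mem_quasimorphisms_iff, hb, add_sub_cancel_right]
    exact he.mem.2
  exact _root_.finrank_quasimorphismSpace_eq_one
    (K.hom_eq_zero (addMonoidHom_eq_zero_of_forall_quasimorphism_bounded hΓ) hc)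
    ⟨_, hf₀⟩ (K.coordQuasimorphism_unbounded hχ b)
    fun f hf => K.exists_near_smul_coordQuasimorphism hΓ he hc hb hf

theorem scl_inl_eq_zero (K : CentralCoordinates S c)
    (hΓ : ∀ f ∈ quasimorphisms Γ, ∃ C, ∀ g, |f g| ≤ C) (he : GeneratesBoundedCohomology e)
    (hc : InjectiveTransgression c) (hb : χ ∘ c = e + coboundary b) {a : A} (ha : χ a = 0)
    (hmem : S.inl (Multiplicative.ofAdd a) ∈ commutator E) :
    scl (S.inl (Multiplicative.ofAdd a)) = 0 := by
  refine scl_eq_zero_of_forall_quasimorphism_bounded hmem fun f hf => ?_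
  obtain ⟨t, C, hC⟩ := K.exists_near_smul_coordQuasimorphism hΓ he hc hb hf
  refine ⟨C + |t * K.coordQuasimorphism χ b 1|, fun n => ?_⟩
  have hn : K.coordQuasimorphism χ b (S.inl (Multiplicative.ofAdd a) ^ n) =
      K.coordQuasimorphism χ b 1 := by
    rw [← map_pow, ← ofAdd_nsmul, coordQuasimorphism_inl, map_nsmul, ha, nsmul_zero, zero_add]
  rw [← hn]
  exact (sub_le_iff_le_add.1 (abs_sub_abs_le_abs_sub _ _)).trans (add_le_add_left (hC _) _)

end Generator

end CentralCoordinates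

section RealHomology

theorem subsingleton_trivialHomology_two {G : Type} [Group G]
    (h : ∀ w : G × G → ℝ, IsTwoCocycle w → ∃ u : G → ℝ, w = coboundary u) :
    Subsingleton (trivialHomology ℝ G 2) := by
  refine subsingleton_of_forall_eq 0 fun y =>
    (Module.forall_dual_apply_eq_zero_iff ℝ y).1 fun F => ?_
  obtain ⟨ω, rfl⟩ := kronecker_surjective (ModuleCat.of ℝ ℝ) F
  obtain ⟨w, rfl⟩ := groupCohomology_H2π_surjective _ ω
  obtain ⟨u, hu⟩ := h w.1 ((groupCohomology.mem_cocycles₂_iff _).1 w.2)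
  obtain ⟨z, hz, hzy⟩ := exists_cycle_linearCombination_eq w y
  exact hzy.symm.trans ((congrArg (Finsupp.linearCombination ℝ · z) hu).trans
    ((linearCombination_coboundary u z).trans (by rw [hz, map_zero])))

variable {E : Type*} [Group E]

theorem IsTwoCocycle.apply_swap_of_mem_center {w : E × E → ℝ} (hw : IsTwoCocycle w)
    (hE : ∀ χ : Additive E →+ ℝ, χ = 0) {x : E} (hx : x ∈ Subgroup.center E) (e : E) :
    w (x, e) = w (e, x) := by
  have hcomm : ∀ e, e * x = x * e := Subgroup.mem_center_iff.1 hx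
  let χ : Additive E →+ ℝ :=
    AddMonoidHom.mk' (fun e => w (x, e.toMul) - w (e.toMul, x)) fun a b => by
      have h₁ := hw x a.toMul b.toMul
      have h₂ := hw a.toMul x b.toMul
      have h₃ := hw a.toMul b.toMul x
      rw [hcomm] at h₂ h₃
      rw [toMul_add]
      linarith
  exact sub_eq_zero.1 (DFunLike.congr_fun (hE χ) (Additive.ofMul e))

theorem exists_real_retraction {B : Type*} [AddGroup B] (hB : ∀ x y : B, x + y = y + x)
    {i : ℝ →+ B} (hi : Function.Injective i) : ∃ r : B →+ ℝ, ∀ t, r (i t) = t := by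
  let _ : AddCommGroup B := { ‹AddGroup B› with add_comm := hB }
  obtain ⟨r, hr⟩ := (Module.Baer.of_divisible ℝ).extension_property_addMonoidHom i hi
    (AddMonoidHom.id ℝ)
  exact ⟨r, DFunLike.congr_fun hr⟩

theorem exists_addMonoidHom_center_cocycleExtension {w : E × E → ℝ} (hw : IsTwoCocycle w) :
    ∃ r : Additive (Subgroup.center (CocycleExtension w hw)) →+ ℝ,
      ∀ t, r (Additive.ofMul ⟨CocycleExtension.incl w hw t, CocycleExtension.incl_mem_center t⟩) =
        t := by
  let i : ℝ →+ Additive (Subgroup.center (CocycleExtension w hw)) :=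
    AddMonoidHom.mk' (fun t => Additive.ofMul
      ⟨CocycleExtension.incl w hw t, CocycleExtension.incl_mem_center t⟩) fun s t =>
        congrArg Additive.ofMul (Subtype.ext (CocycleExtension.incl_add s t))
  have hi : Function.Injective i := fun s t hst => by
    have hfst := congrArg (fun z => (Additive.toMul z).1.fst) hst
    exact sub_left_injective hfst
  exact exists_real_retraction (B := Additive (Subgroup.center (CocycleExtension w hw)))
    (fun x y => Subtype.ext (Subgroup.mem_center_iff.1 y.toMul.2 x.toMul.1)) hi

theorem exists_coordinate_of_ker_le_center {W Γ B : Type*} [Group W] [Group Γ] [AddCommGroup B]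
    {q : W →* Γ} (hq : Function.Surjective q) (hker : q.ker ≤ Subgroup.center W)
    (r : Additive (Subgroup.center W) →+ B) :
    ∃ (R : W → B) (α : Γ × Γ → B), (∀ p p', R (p * p') = R p + R p' + α (q p, q p')) ∧
      ∀ z (hz : z ∈ q.ker) (p : W), R (z * p) = r (Additive.ofMul ⟨z, hker hz⟩) + R p := by
  choose s hs using hq
  have hfibre (p : W) : p * (s (q p))⁻¹ ∈ q.ker := by
    rw [MonoidHom.mem_ker, map_mul, map_inv, hs, mul_inv_cancel]
  have hdefect (g h : Γ) : s g * s h * (s (g * h))⁻¹ ∈ q.ker := by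
    rw [MonoidHom.mem_ker, map_mul, map_mul, map_inv, hs, hs, hs, mul_inv_cancel]
  refine ⟨fun p => r (Additive.ofMul ⟨_, hker (hfibre p)⟩),
    fun x => r (Additive.ofMul ⟨_, hker (hdefect x.1 x.2)⟩), fun p p' => ?_, fun z hz p => ?_⟩
  · rw [← map_add, ← map_add, ← ofMul_mul, ← ofMul_mul]
    refine congrArg (r ∘ Additive.ofMul) (Subtype.ext ?_)
    have hcomm := Subgroup.mem_center_iff.1 (hker (hfibre p')) (s (q p))
    have hsplit : p * p' =
        p * (s (q p))⁻¹ * (s (q p) * (p' * (s (q p'))⁻¹)) * s (q p') := by group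
    simp only [map_mul, Subgroup.coe_mul]
    rw [hsplit, hcomm]
    group
  · rw [← map_add, ← ofMul_mul]
    refine congrArg (r ∘ Additive.ofMul) (Subtype.ext ?_)
    simp only [map_mul, MonoidHom.mem_ker.1 hz, one_mul, mul_assoc, Subgroup.coe_mul]

theorem CocycleExtension.mem_center_of_snd_mem_center {w : E × E → ℝ} {hw : IsTwoCocycle w}
    (hE : ∀ χ : Additive E →+ ℝ, χ = 0) {p : CocycleExtension w hw}
    (hp : p.snd ∈ Subgroup.center E) : p ∈ Subgroup.center (CocycleExtension w hw) := by
  refine Subgroup.mem_center_iff.2 fun x => ?_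
  ext
  · rw [fst_mul, fst_mul, hw.apply_swap_of_mem_center hE hp, add_comm x.fst]
  · exact Subgroup.mem_center_iff.1 hp x.snd

theorem CocycleExtension.eq_coboundary_of_addMonoidHom {G A : Type*} [Group G] [AddCommGroup A]
    {c : G × G → A} {hc : IsTwoCocycle c} {f : CocycleExtension c hc → A}
    (hf : ∀ p p', f (p * p') = f p + f p') (hincl : ∀ a p, f (incl c hc a * p) = a + f p) :
    c = coboundary fun g => f ⟨0, g⟩ := funext fun x => by
  have hmul : (⟨0, x.1⟩ * ⟨0, x.2⟩ : CocycleExtension c hc) =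
      incl c hc (c x) * ⟨0, x.1 * x.2⟩ := by
    ext
    · rw [fst_incl_mul, fst_mul, add_zero, zero_add, add_zero]
    · rw [snd_incl_mul, snd_mul]
  have h := hf ⟨0, x.1⟩ ⟨0, x.2⟩
  rw [hmul, hincl] at h
  rw [coboundary, eq_sub_of_add_eq h]
  abel

theorem CentralCoordinates.exists_eq_coboundary {Γ A : Type*} [Group Γ] [AddCommGroup A]
    {S : GroupExtension (Multiplicative A) E Γ} {c : Γ × Γ → A} (K : CentralCoordinates S c)
    (hS : S.inl.range ≤ Subgroup.center E) (hE : ∀ χ : Additive E →+ ℝ, χ = 0)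
    (hc : SurjectiveTransgression c) {w : E × E → ℝ} (hw : IsTwoCocycle w) :
    ∃ u : E → ℝ, w = coboundary u := by
  let q : CocycleExtension w hw →* Γ := S.rightHom.comp (CocycleExtension.proj w hw)
  have hq : Function.Surjective q :=
    S.rightHom_surjective.comp fun e => ⟨⟨0, e⟩, rfl⟩
  have hker : q.ker ≤ Subgroup.center (CocycleExtension w hw) := fun p hp =>
    CocycleExtension.mem_center_of_snd_mem_center hE (hS (S.range_inl_eq_ker_rightHom ▸ hp))
  obtain ⟨r, hr⟩ := exists_addMonoidHom_center_cocycleExtension hw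
  obtain ⟨R, α, hR, hRker⟩ := exists_coordinate_of_ker_le_center hq hker r
  obtain ⟨l, b, hα⟩ := hc α (isTwoCocycle_of_map_mul hq hR)
  have hq_snd (p : CocycleExtension w hw) : q p = S.rightHom p.snd := rfl
  let f (p : CocycleExtension w hw) : ℝ := R p - l (K.coord p.snd) + b (q p)
  refine ⟨_, CocycleExtension.eq_coboundary_of_addMonoidHom (f := f) (fun p p' => ?_)
    fun t p => ?_⟩
  · simp only [f, hR, hα, CocycleExtension.snd_mul, K.coord_mul, map_add, map_mul, Pi.add_apply,
      Function.comp_apply, coboundary, hq_snd]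
    ring
  · have ht : CocycleExtension.incl w hw t ∈ q.ker := map_one S.rightHom
    simp only [f, hRker _ ht, hr, map_mul, MonoidHom.mem_ker.1 ht, one_mul,
      CocycleExtension.snd_incl_mul]
    ring

end RealHomology

section Coefficients

universe u

variable {k G : Type u} [CommRing k] [Group G] {A B : ModuleCat.{u} k}

theorem H2π_eq_H2π_iff {c d : groupCohomology.cocycles₂ (Rep.trivial k G A)} :
    groupCohomology.H2π _ c = groupCohomology.H2π _ d ↔
      ∃ b : G → A, (fun x => (c.1 x : A)) = (fun x => (d.1 x : A)) + coboundary b := by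
  rw [← sub_eq_zero, ← map_sub, groupCohomology.H2π_eq_zero_iff]
  exact exists_congr fun b => eq_comm.trans sub_eq_iff_eq_add'

/-- The image of a 2-cocycle under a homomorphism of coefficient modules with trivial action. -/
def mapCocycle (f : A ⟶ B) (c : groupCohomology.cocycles₂ (Rep.trivial k G A)) :
    groupCohomology.cocycles₂ (Rep.trivial k G B) :=
  ⟨fun x => f (c.1 x : A), (groupCohomology.mem_cocycles₂_iff _).2
    (IsTwoCocycle.comp ((groupCohomology.mem_cocycles₂_iff _).1 c.2) f.hom.toAddMonoidHom)⟩

theorem coefficientMap₂_H2π (f : A ⟶ B) (c : groupCohomology.cocycles₂ (Rep.trivial k G A)) :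
    coefficientMap₂ f (groupCohomology.H2π _ c) = groupCohomology.H2π _ (mapCocycle f c) :=
  congrArg (fun t => t.hom c) (groupCohomology.H2π_comp_map (A := Rep.trivial k G A)
    (B := Rep.trivial k G B) (MonoidHom.id G) ((Rep.trivialFunctor k G).map f))

theorem kronecker_coefficientMap₂ (f : A ⟶ B) (φ : trivialCohomology₂ G A)
    (x : trivialHomology k G 2) : kronecker (coefficientMap₂ f φ) x = f (kronecker φ x) := by
  obtain ⟨c, rfl⟩ := groupCohomology_H2π_surjective _ φ
  obtain ⟨z, rfl⟩ := groupHomology_H2π_surjective _ x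
  calc kronecker (coefficientMap₂ f (groupCohomology.H2π _ c)) (groupHomology.H2π _ z)
      = Finsupp.linearCombination k (fun x => f (c.1 x : A)) z.1 :=
        (congrArg (kronecker · _) (coefficientMap₂_H2π f c)).trans (kronecker_H2π _ z)
    _ = f (Finsupp.linearCombination k (fun x => (c.1 x : A)) z.1) :=
        (Finsupp.apply_linearCombination k f.hom _ _).symm
    _ = f (kronecker (groupCohomology.H2π _ c) (groupHomology.H2π _ z)) :=
        congrArg f (kronecker_H2π c z).symm

theorem coefficientMap₂_id_apply (φ : trivialCohomology₂ G A) : coefficientMap₂ (𝟙 A) φ = φ := by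
  obtain ⟨c, rfl⟩ := groupCohomology_H2π_surjective _ φ
  exact coefficientMap₂_H2π _ _

theorem coefficientMap₂_comp_apply {C : ModuleCat.{u} k} (f : A ⟶ B) (g : B ⟶ C)
    (φ : trivialCohomology₂ G A) :
    coefficientMap₂ (f ≫ g) φ = coefficientMap₂ g (coefficientMap₂ f φ) := by
  obtain ⟨c, rfl⟩ := groupCohomology_H2π_surjective _ φ
  rw [coefficientMap₂_H2π, coefficientMap₂_H2π, coefficientMap₂_H2π]
  rfl

theorem exists_coefficientMap₂_eq_and_kronecker_eq_smul [IsDomain k] [IsPrincipalIdealRing k]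
    {ε : trivialHomology k G 2 ⟶ A} {s : A ⟶ trivialHomology k G 2} (hs : s ≫ ε = 𝟙 A) {r : k}
    {α : trivialCohomology₂ G A} (hε : ∀ x, r • ε x = kronecker α x) :
    ∃ φ : trivialCohomology₂ G (trivialHomology k G 2),
      coefficientMap₂ ε φ = α ∧ ∀ x, kronecker φ x = r • x := by
  obtain ⟨φ, hφ⟩ := kronecker_surjective (G := G) (trivialHomology k G 2) (r • LinearMap.id)
  have hφr (x) : kronecker φ x = r • x := LinearMap.congr_fun hφ x
  refine ⟨φ - coefficientMap₂ s (coefficientMap₂ ε φ - α), ?_, fun x => ?_⟩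
  · rw [map_sub, ← coefficientMap₂_comp_apply, hs, coefficientMap₂_id_apply, sub_sub_cancel]
  · have hx : kronecker (coefficientMap₂ ε φ - α) x = 0 := by
      rw [map_sub, LinearMap.sub_apply, kronecker_coefficientMap₂, hφr, map_smul, hε, sub_self]
    rw [map_sub, LinearMap.sub_apply, kronecker_coefficientMap₂, hx, map_zero, sub_zero, hφr]

end Coefficients

section Morphisms

variable {Γ E E' A A' : Type*} [Group Γ] [Group E] [Group E'] [AddCommGroup A] [AddCommGroup A']
  {S : GroupExtension (Multiplicative A) E Γ} {S' : GroupExtension (Multiplicative A') E' Γ}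

theorem CentralCoordinates.exists_hom {c : Γ × Γ → A} {c' : Γ × Γ → A'}
    (K : CentralCoordinates S c) (K' : CentralCoordinates S' c')
    (hS' : S'.inl.range ≤ Subgroup.center E') {f : A →+ A'} {b : Γ → A'}
    (hb : f ∘ c = c' + coboundary b) :
    ∃ ψ : E →* E', (∀ a, ψ (S.inl (Multiplicative.ofAdd a)) =
      S'.inl (Multiplicative.ofAdd (f a))) ∧ S'.rightHom.comp ψ = S.rightHom := by
  have hcomm (a : Multiplicative A') (x : E') : Commute x (S'.inl a) :=
    Subgroup.mem_center_iff.1 (hS' ⟨a, rfl⟩) x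
  let u (x : E) : A' := f (K.coord x) + b (S.rightHom x)
  have hu (x y : E) : u (x * y) = u x + u y + c' (S.rightHom x, S.rightHom y) := by
    have hxy := congrFun hb (S.rightHom x, S.rightHom y)
    simp only [Function.comp_apply, Pi.add_apply, coboundary] at hxy
    simp only [u, K.coord_mul, map_add, map_mul, hxy]
    abel
  let ψ : E →* E' := MonoidHom.mk'
    (fun x => S'.inl (Multiplicative.ofAdd (u x)) * K'.sec (S.rightHom x)) fun x y => by
      rw [(hcomm _ _).mul_mul_mul_comm, K'.sec_mul_sec, hu, map_mul S.rightHom]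
      simp only [ofAdd_add, map_mul, mul_assoc]
  have hψ (a : A) (x : E) : ψ (S.inl (Multiplicative.ofAdd a) * x) =
      S'.inl (Multiplicative.ofAdd (f a)) * ψ x := by
    change S'.inl (Multiplicative.ofAdd (u _)) * _ = _ * (S'.inl (Multiplicative.ofAdd (u x)) * _)
    simp only [u, K.coord_inl_mul, map_add, map_mul, S.rightHom_inl, one_mul, add_assoc, ofAdd_add,
      mul_assoc]
  refine ⟨ψ, fun a => ?_, MonoidHom.ext fun x => ?_⟩
  · simpa only [map_one, mul_one] using hψ a 1
  · change S'.rightHom (_ * _) = _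
    rw [map_mul, S'.rightHom_inl, one_mul, K'.rightHom_sec]

theorem surjective_of_rightHom_comp_eq {f : A → A'} (hf : Function.Surjective f) {ψ : E →* E'}
    (hψ : ∀ a, ψ (S.inl (Multiplicative.ofAdd a)) = S'.inl (Multiplicative.ofAdd (f a)))
    (hψ' : S'.rightHom.comp ψ = S.rightHom) : Function.Surjective ψ := by
  intro y
  obtain ⟨x, hx⟩ := S.rightHom_surjective (S'.rightHom y)
  have hmem : y * (ψ x)⁻¹ ∈ S'.inl.range := by
    rw [S'.range_inl_eq_ker_rightHom, MonoidHom.mem_ker, map_mul, map_inv, ← MonoidHom.comp_apply,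
      hψ', hx, mul_inv_cancel]
  obtain ⟨a', ha'⟩ := hmem
  obtain ⟨a, ha⟩ := hf a'.toAdd
  refine ⟨S.inl (Multiplicative.ofAdd a) * x, ?_⟩
  rw [map_mul, hψ, ha, ofAdd_toAdd, ha', inv_mul_cancel_right]

theorem ker_le_range_inl_of_rightHom_comp_eq {ψ : E →* E'} (hψ : S'.rightHom.comp ψ = S.rightHom) :
    ψ.ker ≤ S.inl.range := by
  rw [S.range_inl_eq_ker_rightHom, ← hψ]
  exact fun x hx => (congrArg S'.rightHom (MonoidHom.mem_ker.1 hx)).trans (map_one _)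

end Morphisms

theorem exists_normalization {M : Type*} [AddCommGroup M] [Module ℤ M] {κ : M →ₗ[ℤ] ℤ}
    (hκ : κ ≠ 0) : ∃ (m : ℕ) (ε : M →ₗ[ℤ] ℤ), 0 < m ∧ Set.range κ = {n : ℤ | (m : ℤ) ∣ n} ∧
      (∀ x, (m : ℤ) * ε x = κ x) ∧ Function.Surjective ε := by
  let m : ℕ := (Submodule.IsPrincipal.generator (LinearMap.range κ)).natAbs
  have hrange (n : ℤ) : n ∈ Set.range κ ↔ (m : ℤ) ∣ n :=
    (Submodule.IsPrincipal.mem_iff_generator_dvd (LinearMap.range κ)).trans Int.natAbs_dvd.symm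
  have hm : (m : ℤ) ≠ 0 := fun hm => hκ (LinearMap.ext fun x => by
    have hx := (hrange (κ x)).1 ⟨x, rfl⟩
    rwa [hm, zero_dvd_iff] at hx)
  choose ε hε using fun x => (hrange (κ x)).1 ⟨x, rfl⟩
  let ε' : M →ₗ[ℤ] ℤ :=
    { toFun := ε
      map_add' := fun x y => mul_left_cancel₀ hm (by rw [← hε, map_add, hε, hε, mul_add])
      map_smul' := fun n x =>
        mul_left_cancel₀ hm (by
          rw [← hε, κ.map_smul, hε, smul_eq_mul, RingHom.id_apply, smul_eq_mul, mul_left_comm]) }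
  refine ⟨m, ε', Nat.pos_of_ne_zero (Nat.cast_ne_zero.1 hm), Set.ext hrange,
    fun x => (hε x).symm, fun n => ?_⟩
  obtain ⟨x, hx⟩ := (hrange (m * n)).2 (dvd_mul_right _ _)
  exact ⟨x, mul_left_cancel₀ hm ((hε x).symm.trans hx)⟩

theorem addMonoidHom_eq_zero_of_finite_trivialHomology_one {Γ : Type} [Group Γ]
    [Finite (trivialHomology ℤ Γ 1)] (χ : Additive Γ →+ ℝ) : χ = 0 := by
  have : Finite (Abelianization Γ) :=
    Finite.of_equiv (trivialHomology ℤ Γ 1)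
      ((groupHomology.H1AddEquivOfIsTrivial (Rep.trivial ℤ Γ ℤ)).trans
        (TensorProduct.rid ℤ (Additive (Abelianization Γ))).toAddEquiv).toEquiv
  refine AddMonoidHom.ext fun g => ?_
  obtain ⟨n, hn, hgn⟩ :=
    isOfFinOrder_iff_pow_eq_one.1 (isOfFinOrder_of_finite (Abelianization.of g.toMul))
  have hχ := congrArg (Abelianization.lift (AddMonoidHom.toMultiplicativeRight χ)) hgn
  rw [map_pow, map_one, Abelianization.lift_apply_of] at hχ
  have hnχ : n • χ g = 0 := hχ
  exact (smul_eq_zero.1 hnχ).resolve_left hn.ne'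

theorem EulerSetup.quasimorphism_bounded {Γ : Type} [Group Γ] {ρ : Γ →* HomeoPlus}
    (hρ : EulerSetup ρ) : ∀ f ∈ quasimorphisms Γ, ∃ C, ∀ g, |f g| ≤ C := fun f hf => by
  have := hρ.finite_H1
  exact (mem_trivialQuasimorphisms_iff_of_hom_eq_zero (f := ⟨f, hf⟩)
    addMonoidHom_eq_zero_of_finite_trivialHomology_one).1 (hρ.quasimorphism_trivial ⟨f, hf⟩)

theorem eulerCocycle_mem_boundedCocycles₂ {Γ : Type} [Group Γ] (ρ : Γ →* HomeoPlus) :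
    (fun x => (eulerCocycle ρ x : ℝ)) ∈ boundedCocycles₂ Γ :=
  mem_boundedCocycles₂_iff.2
    ⟨IsTwoCocycle.comp (eulerCocycle_identity ρ) (Int.castAddHom ℝ), 1, fun x => by
      rw [abs_of_nonneg (Int.cast_nonneg (eulerCocycle_mem ρ x).1)]
      exact_mod_cast (eulerCocycle_mem ρ x).2⟩

theorem EulerSetup.generatesBoundedCohomology {Γ : Type} [Group Γ] {ρ : Γ →* HomeoPlus}
    (hρ : EulerSetup ρ) : GeneratesBoundedCohomology fun x => (eulerCocycle ρ x : ℝ) :=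
  ⟨eulerCocycle_mem_boundedCocycles₂ ρ, hρ.span_boundedEulerClass, hρ.finrank_boundedCohomology⟩

section ExtensionOfClass

variable {Γ E : Type} [Group Γ] [Group E] {A : ModuleCat.{0} ℤ}
  {S : GroupExtension (Multiplicative A) E Γ} {φ : trivialCohomology₂ Γ A} {m : ℕ}
  {ε : A ⟶ ModuleCat.of ℤ ℤ} {e : groupCohomology.cocycles₂ (Rep.trivial ℤ Γ (ModuleCat.of ℤ ℤ))}

theorem injectiveTransgression_of_kronecker {c : groupCohomology.cocycles₂ (Rep.trivial ℤ Γ A)}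
    (hm : m ≠ 0) (hc : ∀ a, ∃ y, kronecker (groupCohomology.H2π _ c) y = m • a) :
    InjectiveTransgression fun x => (c.1 x : A) :=
  injectiveTransgression_of_evaluation (Nat.cast_ne_zero.2 hm) fun a => by
    obtain ⟨y, hy⟩ := hc a
    obtain ⟨z, hz, hzy⟩ := exists_cycle_linearCombination_eq c y
    exact ⟨z, hz, (hzy.trans hy).trans (natCast_zsmul a m).symm⟩

theorem exists_intCast_comp_eq_add_coboundary
    {c : groupCohomology.cocycles₂ (Rep.trivial ℤ Γ A)}
    (h : coefficientMap₂ ε (groupCohomology.H2π _ c) = groupCohomology.H2π _ e) :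
    ∃ b : Γ → ℝ, (Int.castAddHom ℝ).comp ε.hom.toAddMonoidHom ∘ (fun x => (c.1 x : A)) =
      (fun x => ((e.1 x : ℤ) : ℝ)) + coboundary b := by
  rw [coefficientMap₂_H2π, H2π_eq_H2π_iff] at h
  obtain ⟨b, hb⟩ := h
  refine ⟨fun g => ((b g : ℤ) : ℝ), funext fun x => ?_⟩
  refine (congrArg (Int.cast : ℤ → ℝ) (congrFun hb x)).trans ?_
  simp only [Pi.add_apply, coboundary]
  push_cast
  rfl

namespace IsCentralExtensionOfClass

theorem addMonoidHom_eq_zero (hS : IsCentralExtensionOfClass S φ)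
    (hΓ : ∀ χ : Additive Γ →+ ℝ, χ = 0) (hm : m ≠ 0) (hφ : ∀ a, ∃ y, kronecker φ y = m • a)
    (χ : Additive E →+ ℝ) : χ = 0 := by
  obtain ⟨c, rfl, ⟨K⟩⟩ := hS.exists_centralCoordinates
  exact K.hom_eq_zero hΓ (injectiveTransgression_of_kronecker hm hφ) χ

theorem finrank_quasimorphismSpace_eq_one (hS : IsCentralExtensionOfClass S φ)
    (hΓ : ∀ f ∈ quasimorphisms Γ, ∃ C, ∀ g, |f g| ≤ C)
    (he : GeneratesBoundedCohomology fun x => ((e.1 x : ℤ) : ℝ)) (hm : m ≠ 0)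
    (hφ : ∀ a, ∃ y, kronecker φ y = m • a)
    (hε : coefficientMap₂ ε φ = groupCohomology.H2π _ e) :
    Module.finrank ℝ (QuasimorphismSpace E) = 1 := by
  obtain ⟨c, rfl, ⟨K⟩⟩ := hS.exists_centralCoordinates
  obtain ⟨b, hb⟩ := exists_intCast_comp_eq_add_coboundary hε
  exact K.finrank_quasimorphismSpace_eq_one hΓ he (injectiveTransgression_of_kronecker hm hφ) hb

theorem scl_inl_eq_zero (hS : IsCentralExtensionOfClass S φ)
    (hΓ : ∀ f ∈ quasimorphisms Γ, ∃ C, ∀ g, |f g| ≤ C)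
    (he : GeneratesBoundedCohomology fun x => ((e.1 x : ℤ) : ℝ)) (hm : m ≠ 0)
    (hφ : ∀ a, ∃ y, kronecker φ y = m • a)
    (hε : coefficientMap₂ ε φ = groupCohomology.H2π _ e) {a : A} (ha : ε a = (0 : ℤ))
    (hmem : S.inl (Multiplicative.ofAdd a) ∈ commutator E) :
    scl (S.inl (Multiplicative.ofAdd a)) = 0 := by
  obtain ⟨c, rfl, ⟨K⟩⟩ := hS.exists_centralCoordinates
  obtain ⟨b, hb⟩ := exists_intCast_comp_eq_add_coboundary hε
  exact K.scl_inl_eq_zero hΓ he (injectiveTransgression_of_kronecker hm hφ) hb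
    ((congrArg (Int.cast : ℤ → ℝ) ha).trans Int.cast_zero) hmem

theorem exists_hom {B : ModuleCat.{0} ℤ} {E' : Type} [Group E']
    {S' : GroupExtension (Multiplicative B) E' Γ} {α : trivialCohomology₂ Γ B} {f : A ⟶ B}
    (hS : IsCentralExtensionOfClass S φ) (hS' : IsCentralExtensionOfClass S' α)
    (hf : coefficientMap₂ f φ = α) :
    ∃ ψ : E →* E', (∀ a : A, ψ (S.inl (Multiplicative.ofAdd a)) =
      S'.inl (Multiplicative.ofAdd (f a))) ∧ S'.rightHom.comp ψ = S.rightHom := by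
  obtain ⟨c, rfl, ⟨K⟩⟩ := hS.exists_centralCoordinates
  obtain ⟨c', rfl, ⟨K'⟩⟩ := hS'.exists_centralCoordinates
  rw [coefficientMap₂_H2π, H2π_eq_H2π_iff] at hf
  obtain ⟨b, hb⟩ := hf
  exact K.exists_hom K' hS'.1 (f := f.hom.toAddMonoidHom) hb

theorem subsingleton_trivialHomology_two
    {S : GroupExtension (Multiplicative (trivialHomology ℤ Γ 2)) E Γ}
    {φ : trivialCohomology₂ Γ (trivialHomology ℤ Γ 2)} (hS : IsCentralExtensionOfClass S φ)
    (hΓ : ∀ χ : Additive Γ →+ ℝ, χ = 0) (hm : m ≠ 0) (hφ : ∀ x, kronecker φ x = m • x) :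
    Subsingleton (trivialHomology ℝ E 2) := by
  have hE := hS.addMonoidHom_eq_zero hΓ hm fun x => ⟨x, hφ x⟩
  obtain ⟨c, rfl, ⟨K⟩⟩ := hS.exists_centralCoordinates
  exact _root_.subsingleton_trivialHomology_two fun w hw =>
    K.exists_eq_coboundary hS.1 hE (surjectiveTransgression_of_kronecker hm c hφ) hw

theorem scl_image_commutator_eq {Γt : Type} [Group Γt]
    {St : GroupExtension (Multiplicative (ModuleCat.of ℤ ℤ)) Γt Γ}
    (hS : IsCentralExtensionOfClass S φ)
    (hΓ : ∀ f ∈ quasimorphisms Γ, ∃ C, ∀ g, |f g| ≤ C)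
    (he : GeneratesBoundedCohomology fun x => ((e.1 x : ℤ) : ℝ)) (hm : m ≠ 0)
    (hφ : ∀ a, ∃ y, kronecker φ y = m • a)
    (hε : coefficientMap₂ ε φ = groupCohomology.H2π _ e) {ψ : E →* Γt}
    (hψ : Function.Surjective ψ) (hker : ψ.ker ≤ S.inl.range)
    (hψε : ∀ a : A, ψ (S.inl (Multiplicative.ofAdd a)) = St.inl (Multiplicative.ofAdd (ε a))) :
    scl '' (commutator E : Set E) = scl '' (commutator Γt : Set Γt) := by
  refine _root_.scl_image_commutator_eq hψ (hker.trans hS.1) fun x hx hmem => ?_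
  obtain ⟨a, rfl⟩ := hker hx
  refine hS.scl_inl_eq_zero hΓ he hm hφ hε (a := a.toAdd) ?_ hmem
  exact Multiplicative.ofAdd.injective (St.inl_injective
    (((hψε a.toAdd).symm.trans hx).trans (map_one _).symm))

end IsCentralExtensionOfClass

end ExtensionOfClass

theorem kronecker_H2π_ne_zero {Γ : Type} [Group Γ]
    (hΓ : ∀ f ∈ quasimorphisms Γ, ∃ C, ∀ g, |f g| ≤ C)
    {e : groupCohomology.cocycles₂ (Rep.trivial ℤ Γ (ModuleCat.of ℤ ℤ))}
    (he : GeneratesBoundedCohomology fun x => ((e.1 x : ℤ) : ℝ)) :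
    kronecker (groupCohomology.H2π _ e) ≠ 0 := fun hzero => by
  obtain ⟨z, hz, hez⟩ := he.exists_cycle_linearCombination_ne_zero hΓ
  refine hez ?_
  calc Finsupp.linearCombination ℤ (fun x => ((e.1 x : ℤ) : ℝ)) z
      = (Finsupp.linearCombination ℤ (fun x => (e.1 x : ℤ)) z : ℤ) :=
        (Finsupp.apply_linearCombination ℤ (Int.castAddHom ℝ).toIntLinearMap _ z).symm
    _ = (0 : ℤ) := congrArg Int.cast
        ((kronecker_H2π e ⟨z, mem_cycles₂_trivial_iff.2 hz⟩).symm.trans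
          (LinearMap.congr_fun hzero _))
    _ = 0 := Int.cast_zero

theorem mainTheorem8_general {Γ : Type} [Group Γ] [Group.IsFinitelyPresented Γ]
    (hΓ : ∀ f ∈ quasimorphisms Γ, ∃ C, ∀ g, |f g| ≤ C)
    (e : groupCohomology.cocycles₂ (Rep.trivial ℤ Γ (ModuleCat.of ℤ ℤ)))
    (he : GeneratesBoundedCohomology fun x => ((e.1 x : ℤ) : ℝ)) :
    ∃ (m : ℕ) (ε : trivialHomology ℤ Γ 2 ⟶ ModuleCat.of ℤ ℤ),
      0 < m ∧
      Set.range (kronecker (groupCohomology.H2π _ e)) = {n : ℤ | (m : ℤ) ∣ n} ∧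
      (∀ x : trivialHomology ℤ Γ 2, (m : ℤ) * ε x = kronecker (groupCohomology.H2π _ e) x) ∧
      (∃ φ : trivialCohomology₂ Γ (trivialHomology ℤ Γ 2),
        coefficientMap₂ ε φ = groupCohomology.H2π _ e ∧ ∀ x, kronecker φ x = m • x) ∧
      ∀ φ : trivialCohomology₂ Γ (trivialHomology ℤ Γ 2),
        coefficientMap₂ ε φ = groupCohomology.H2π _ e → (∀ x, kronecker φ x = m • x) →
        ∀ (E Γt : Type) [Group E] [Group Γt]
          (S : GroupExtension (Multiplicative (trivialHomology ℤ Γ 2)) E Γ)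
          (St : GroupExtension (Multiplicative (ModuleCat.of ℤ ℤ)) Γt Γ),
          IsCentralExtensionOfClass S φ → IsCentralExtensionOfClass St (groupCohomology.H2π _ e) →
          (Group.IsFinitelyPresented E ∧ Subsingleton (trivialHomology ℝ E 2)) ∧
          (∃ ψ : E →* Γt, Function.Surjective ψ ∧
            (∀ x : trivialHomology ℤ Γ 2,
              ψ (S.inl (Multiplicative.ofAdd x)) = St.inl (Multiplicative.ofAdd (ε x))) ∧
            ψ.ker ≤ S.inl.range ∧ St.rightHom.comp ψ = S.rightHom) ∧
          (∀ ψ : E →* Γt, Function.Surjective ψ → Function.Bijective (quasimorphismMap ψ)) ∧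
          Module.finrank ℝ (QuasimorphismSpace Γt) = 1 ∧
          Module.finrank ℝ (QuasimorphismSpace E) = 1 ∧
          scl '' (commutator E : Set E) = scl '' (commutator Γt : Set Γt) := by
  have hhom := addMonoidHom_eq_zero_of_forall_quasimorphism_bounded hΓ
  obtain ⟨m, ε, hm, hrange, hε, hεsurj⟩ := exists_normalization (kronecker_H2π_ne_zero hΓ he)
  obtain ⟨s, hs⟩ := ε.exists_rightInverse_of_surjective (LinearMap.range_eq_top.2 hεsurj)
  have hsε : ModuleCat.ofHom s ≫ ModuleCat.ofHom ε = 𝟙 _ := ModuleCat.hom_ext hs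
  obtain ⟨φ₀, hφ₀, hφ₀m⟩ := exists_coefficientMap₂_eq_and_kronecker_eq_smul hsε hε
  refine ⟨m, ModuleCat.ofHom ε, hm, hrange, hε,
    ⟨φ₀, hφ₀, fun x => (hφ₀m x).trans (Nat.cast_smul_eq_nsmul ℤ m x)⟩, ?_⟩
  intro φ hφ hφm E Γt _ _ S St hS hSt
  have hEval (x) : ∃ y, kronecker φ y = m • x := ⟨x, hφm x⟩
  have hEvalt (n : ModuleCat.of ℤ ℤ) : ∃ y, kronecker (groupCohomology.H2π _ e) y = m • n :=
    hrange.ge ⟨n, nsmul_eq_mul m (n : ℤ)⟩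
  have hE := hS.addMonoidHom_eq_zero hhom hm.ne' hEval
  have hQE := hS.finrank_quasimorphismSpace_eq_one hΓ he hm.ne' hEval hφ
  have hQt := hSt.finrank_quasimorphismSpace_eq_one hΓ he hm.ne' hEvalt
    (coefficientMap₂_id_apply _)
  obtain ⟨ψ, hψε, hψ⟩ := hS.exists_hom hSt hφ
  have hψsurj := surjective_of_rightHom_comp_eq hεsurj hψε hψ
  have hψker := ker_le_range_inl_of_rightHom_comp_eq hψ
  have := finite_trivialHomology_two ℤ Γ
  have := isFinitelyPresented_multiplicative_of_finite (trivialHomology ℤ Γ 2)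
  exact ⟨⟨isFinitelyPresented_of_groupExtension S,
      hS.subsingleton_trivialHomology_two hhom hm.ne' hφm⟩, ⟨ψ, hψsurj, hψε, hψker, hψ⟩,
    fun _ => quasimorphismMap_bijective hE hQE hQt, hQt, hQE,
    hS.scl_image_commutator_eq hΓ he hm.ne' hEval hφ hψsurj hψker hψε⟩

theorem mainTheorem8 {Γ : Type} [Group Γ] (ρ : Γ →* HomeoPlus) (hρ : EulerSetup ρ) :
    ∃ (m : ℕ) (ε : trivialHomology ℤ Γ 2 ⟶ ModuleCat.of ℤ ℤ),
      0 < m ∧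
      Set.range (kronecker (eulerClass ρ)) = {n : ℤ | (m : ℤ) ∣ n} ∧
      (∀ x : trivialHomology ℤ Γ 2, (m : ℤ) * ε x = kronecker (eulerClass ρ) x) ∧
      (∃ φ : trivialCohomology₂ Γ (trivialHomology ℤ Γ 2),
        coefficientMap₂ ε φ = eulerClass ρ ∧ ∀ x, kronecker φ x = m • x) ∧
      ∀ φ : trivialCohomology₂ Γ (trivialHomology ℤ Γ 2),
        coefficientMap₂ ε φ = eulerClass ρ → (∀ x, kronecker φ x = m • x) →
        ∀ (E Γt : Type) [Group E] [Group Γt]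
          (S : GroupExtension (Multiplicative (trivialHomology ℤ Γ 2)) E Γ)
          (St : GroupExtension (Multiplicative (ModuleCat.of ℤ ℤ)) Γt Γ),
          IsCentralExtensionOfClass S φ → IsCentralExtensionOfClass St (eulerClass ρ) →
          (Group.IsFinitelyPresented E ∧ Subsingleton (trivialHomology ℝ E 2)) ∧
          (∃ ψ : E →* Γt, Function.Surjective ψ ∧
            (∀ x : trivialHomology ℤ Γ 2,
              ψ (S.inl (Multiplicative.ofAdd x)) = St.inl (Multiplicative.ofAdd (ε x))) ∧
            ψ.ker ≤ S.inl.range ∧ St.rightHom.comp ψ = S.rightHom) ∧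
          (∀ ψ : E →* Γt, Function.Surjective ψ →
            (∀ x : trivialHomology ℤ Γ 2,
              ψ (S.inl (Multiplicative.ofAdd x)) = St.inl (Multiplicative.ofAdd (ε x))) →
            ψ.ker ≤ S.inl.range →
            Function.Bijective (quasimorphismMap ψ)) ∧
          Module.finrank ℝ (QuasimorphismSpace Γt) = 1 ∧
          Module.finrank ℝ (QuasimorphismSpace E) = 1 ∧
          scl '' (commutator E : Set E) = scl '' (commutator Γt : Set Γt) :=
  have := hρ.finitelyPresented
  let ⟨m, ε, hm, hrange, hε, hφ, h⟩ :=
    mainTheorem8_general hρ.quasimorphism_bounded _ hρ.generatesBoundedCohomology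
  ⟨m, ε, hm, hrange, hε, hφ, fun φ hφε hφm E Γt _ _ S St hS hSt =>
    let ⟨hE, hex, hbij, hQ⟩ := h φ hφε hφm E Γt S St hS hSt
    ⟨hE, hex, fun ψ hψ _ _ => hbij ψ hψ, hQ⟩⟩
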